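/- All Hilbert spaces are finite-dimensional. Let $|\psi\rangle^{RAB}\in\mathcal H^R\otimes\mathcal H^A\otimes\mathcal H^B$ be a unit vector, and write $\psi^{RA},\psi^A,\psi^B$ for its reduced states. Let $$S=\Big\{\tfrac{\mathrm{tr}_R[(\Lambda\otimes 1)\psi^{RA}]}{\mathrm{tr}[(\Lambda\otimes 1)\psi^{RA}]}:\ \Lambda\ge 0 \text{ on } \mathcal H^R,\ \mathrm{tr}[(\Lambda\otimes 1)\psi^{RA}]\neq 0\Big\}$$ be the set of states of $A$ that can be steered from $R$. **Koashi–Imoto decomposition.** Let $\mathrm{supp}(\psi^A)=\bigoplus_{j=0}^{J-1}\mathcal H^{a_j^L}\otimes\mathcal H^{a_j^R}$ (with nonzero spaces $\mathcal H^{a_j^L},\mathcal H^{a_j^R}$) be the Koashi–Imoto decomposition of $S$, that is, there are density operators $\omega_j$ on $\mathcal H^{a_j^L}$ such that 1. every $\rho\in S$ has the form $\rho=\bigoplus_j q_j\,\omega_j\otimes\varphi_j$ for some probability distribution $(q_j)$ and density operators $\varphi_j$ on $\mathcal H^{a_j^R}$ (both depending on $\rho$); 2. for every completely positive trace-preserving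 map $\mathcal T$ on $\mathcal B(\mathcal H^A)$ with $\mathcal T(\rho)=\rho$ for all $\rho\in S$, and every Stinespring isometry $W:\mathcal H^A\to\mathcal H^A\otimes\mathcal H^E$ of $\mathcal T$, the restriction of $W$ to $\mathrm{supp}(\psi^A)$ is $\bigoplus_j V_j\otimes 1^{a_j^R}$ for isometries $V_j:\mathcal H^{a_j^L}\to\mathcal H^{a_j^L}\otimes\mathcal H^E$ with $\mathrm{tr}_E(V_j\omega_jV_j^\dagger)=\omega_j$. **Theorem.** There is a decomposition $\mathrm{supp}(\psi^B)=\bigoplus_{j}\mathcal H^{b_j^L}\otimes\mathcal H^{b_j^R}$ along which $$|\psi\rangle^{RAB}=\bigoplus_{j}\sqrt{p(j)}\;|\omega_j\rangle^{a_j^Lb_j^L}\otimes|\phi_j\rangle^{Ra_j^Rb_j^R}$$ with a probability distribution $p$ and unit vectors $|\omega_j\rangle,|\phi_j\rangle$. For every such decomposition, let $\lambda_0^{a_j^L}$ be the largest eigenvalue of $\mathrm{tr}_{b_j^L}|\omega_j\rangle\langle\omega_j|$. Then for every $\delta>0$ there are integers $K,L\ge 1$ and a finite-round LOCC map $\mathcal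 M$ between $A$ and $B$ that achieves exact state merging in the catalytic setting, $$(\mathrm{id}^R\otimes\mathcal M)\big(\psi^{RAB}\otimes\Phi_K^{\overline A\,\overline B}\big)=\psi^{RB'B}\otimes\Phi_L^{\overline A\,\overline B},$$ at entanglement cost $$\log_2K-\log_2L\ \le\ \max_{j}\log_2\!\big(\lambda_0^{a_j^L}\dim\mathcal H^{a_j^R}\big)+\delta .$$ Here $B'$ is a system of $B$ that is a copy of $A$, $\psi^{RB'B}$ is the state $\psi^{RAB}$ with $A$ replaced by $B'$, and $\Phi_K=|\Phi_K\rangle\langle\Phi_K|$ with $|\Phi_K\rangle=K^{-1/2}\sum_{l<K}|l\rangle\otimes|l\rangle$ (shared between $A$ and $B$). -/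

import Mathlib

open scoped Matrix Kronecker ComplexOrder

noncomputable section

namespace StateMerging

/-! A finite-dimensional Hilbert space with its computational basis is represented by the finite
index type of that basis; operators are matrices, and composite systems are product types. -/

/-- Density operators. -/
def IsState {X : Type} [Fintype X] (ρ : Matrix X X ℂ) : Prop :=
  ρ.PosSemidef ∧ ρ.trace = 1

/-- Partial trace over the first tensor factor. -/
def traceLeft {E X Y : Type} [Fintype E] (M : Matrix (E × X) (E × Y) ℂ) : Matrix X Y ℂ :=
  fun x y => ∑ e, M (e, x) (e, y)

/-- Partial trace over the second tensor factor. -/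
def traceRight {E X Y : Type} [Fintype E] (M : Matrix (X × E) (Y × E) ℂ) : Matrix X Y ℂ :=
  fun x y => ∑ e, M (x, e) (y, e)

/-- The operator `|v⟩⟨v|`. -/
def pureState {X : Type} (v : X → ℂ) : Matrix X X ℂ :=
  Matrix.vecMulVec v (star v)

/-! ### Local operations and classical communication -/

/-- The map `ρ ↦ M ρ M†`. -/
def conjMap {X Y : Type} [Fintype X] (M : Matrix Y X ℂ) : Matrix X X ℂ →ₗ[ℂ] Matrix Y Y ℂ where
  toFun ρ := M * ρ * Mᴴ
  map_add' ρ σ := by rw [Matrix.mul_add, Matrix.add_mul]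
  map_smul' c ρ := by simp

/-- Finite-round (two-way) LOCC maps between the parties `A` and `B`. A protocol either stops, or
one of the parties performs a measurement `{M_m}` with `∑ m, M_m† M_m = 1` on the local system, whose
output system may be different from the input system, broadcasts the outcome `m`, and the parties
continue with a protocol that may depend on `m`. All the outcomes are finally forgotten.
Local isometries are measurements with one outcome, and local channels are measurements whose
outcome is ignored. -/
inductive IsFiniteRoundLOCC : ∀ {A B A' B' : Type},
    (Matrix (A × B) (A × B) ℂ →ₗ[ℂ] Matrix (A' × B') (A' × B') ℂ) → Prop
  | done {A B : Type} :
      IsFiniteRoundLOCC (LinearMap.id : Matrix (A × B) (A × B) ℂ →ₗ[ℂ] Matrix (A × B) (A × B) ℂ)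
  | measureA {A B C A' B' : Type} [Fintype A] [DecidableEq A] [Fintype B] [DecidableEq B]
      [Fintype C] (n : ℕ) (M : Fin n → Matrix C A ℂ) (hM : ∑ m, (M m)ᴴ * M m = 1)
      (E : Fin n → (Matrix (C × B) (C × B) ℂ →ₗ[ℂ] Matrix (A' × B') (A' × B') ℂ))
      (hE : ∀ m, IsFiniteRoundLOCC (E m)) :
      IsFiniteRoundLOCC (∑ m, E m ∘ₗ conjMap (M m ⊗ₖ (1 : Matrix B B ℂ)))
  | measureB {A B C A' B' : Type} [Fintype A] [DecidableEq A] [Fintype B] [DecidableEq B]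
      [Fintype C] (n : ℕ) (M : Fin n → Matrix C B ℂ) (hM : ∑ m, (M m)ᴴ * M m = 1)
      (E : Fin n → (Matrix (A × C) (A × C) ℂ →ₗ[ℂ] Matrix (A' × B') (A' × B') ℂ))
      (hE : ∀ m, IsFiniteRoundLOCC (E m)) :
      IsFiniteRoundLOCC (∑ m, E m ∘ₗ conjMap ((1 : Matrix A A ℂ) ⊗ₖ M m))

/-- The action of `id^R ⊗ 𝓜` on an operator, computed block by block. -/
def idTensor (R : Type) {X Y : Type} (𝓜 : Matrix X X ℂ →ₗ[ℂ] Matrix Y Y ℂ)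
    (ρ : Matrix (R × X) (R × X) ℂ) : Matrix (R × Y) (R × Y) ℂ :=
  fun p q => 𝓜 (fun x y => ρ (p.1, x) (q.1, y)) p.2 q.2

/-! ### Exact state merging -/

/-- The normalized maximally entangled state of Schmidt rank `K` in `ℂ^K ⊗ ℂ^K`. -/
def maxEntangled (K : ℕ) (k k' : Fin K) : ℂ :=
  if k = k' then ((1 / Real.sqrt K : ℝ) : ℂ) else 0

/-- The vector `|ψ⟩^{RAB} ⊗ |Φ_K⟩`, with `A` holding `A × Fin K` and `B` holding `B × Fin K`. -/
def initialVector {R A B : Type} (ψ : R × A × B → ℂ) (K : ℕ) :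
    R × ((A × Fin K) × (B × Fin K)) → ℂ :=
  fun x => ψ (x.1, x.2.1.1, x.2.2.1) * maxEntangled K x.2.1.2 x.2.2.2

/-- The vector `|ψ⟩^{RB'B} ⊗ |Φ_L⟩`, with `A` holding `Fin L` and `B` holding `(B' × B) × Fin L`,
where `B'` is a copy of the system `A`. -/
def finalVector {R A B : Type} (ψ : R × A × B → ℂ) (L : ℕ) :
    R × (Fin L × ((A × B) × Fin L)) → ℂ :=
  fun x => ψ (x.1, x.2.2.1.1, x.2.2.1.2) * maxEntangled L x.2.1 x.2.2.2

/-- Exact state merging of `|ψ⟩^{RAB}` in the catalytic setting, consuming a maximally entangled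
state of Schmidt rank `K` and returning one of Schmidt rank `L`. -/
def ExactMerging {R A B : Type} (ψ : R × A × B → ℂ) (K L : ℕ) : Prop :=
  ∃ 𝓜 : Matrix ((A × Fin K) × (B × Fin K)) ((A × Fin K) × (B × Fin K)) ℂ →ₗ[ℂ]
      Matrix (Fin L × ((A × B) × Fin L)) (Fin L × ((A × B) × Fin L)) ℂ,
    IsFiniteRoundLOCC 𝓜 ∧
      idTensor R 𝓜 (pureState (initialVector ψ K)) = pureState (finalVector ψ L)

/-! ### The Koashi-Imoto decomposition -/

/-- An isometric embedding `U` of `⨁ j, ℂ^(dL j) ⊗ ℂ^(dR j)` into the space with basis `A`, that is,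
a decomposition of the range of `U` as the direct sum of the spaces `a_j^L ⊗ a_j^R`. -/
structure BlockDecomposition (A : Type) [Fintype A] where
  J : ℕ
  dL : Fin J → ℕ
  dR : Fin J → ℕ
  dL_pos : ∀ j, 0 < dL j
  dR_pos : ∀ j, 0 < dR j
  U : Matrix A (Σ j : Fin J, Fin (dL j) × Fin (dR j)) ℂ
  isometry : Uᴴ * U = 1

/-- `D` is the Koashi-Imoto decomposition of the set `S` of states of `A`, and `ω j` are the
corresponding states of the spaces `a_j^L`. -/
structure IsKoashiImoto {A : Type} [Fintype A] [DecidableEq A] (S : Set (Matrix A A ℂ))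
    (D : BlockDecomposition A) (ω : ∀ j, Matrix (Fin (D.dL j)) (Fin (D.dL j)) ℂ) : Prop where
  /-- the decomposed space is the joint support of the states in `S` -/
  support : LinearMap.range D.U.mulVecLin = ⨆ ρ ∈ S, LinearMap.range ρ.mulVecLin
  state : ∀ j, IsState (ω j)
  /-- every state in `S` is of the form `⨁ j, q j • ω j ⊗ φ j` with `ω` independent of the state -/
  form : ∀ ρ ∈ S, ∃ (q : Fin D.J → ℝ) (φ : ∀ j, Matrix (Fin (D.dR j)) (Fin (D.dR j)) ℂ),
    (∀ j, 0 ≤ q j) ∧ ∑ j, q j = 1 ∧ (∀ j, IsState (φ j)) ∧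
      ρ = D.U * Matrix.blockDiagonal' (fun j => (q j : ℂ) • (ω j ⊗ₖ φ j)) * D.Uᴴ
  /-- maximality: for every channel `ρ ↦ tr_E (W ρ W†)`, with `W` an isometry, that leaves all the
  states in `S` invariant, `W` acts on the decomposed space as `⨁ j, V j ⊗ 1` where `V j` is an
  isometry from `a_j^L` to `a_j^L ⊗ E` whose channel leaves `ω j` invariant -/
  maximal : ∀ (n : ℕ) (W : Matrix (A × Fin n) A ℂ), Wᴴ * W = 1 →
    (∀ ρ ∈ S, traceRight (W * ρ * Wᴴ) = ρ) →
    ∃ V : ∀ j, Matrix (Fin (D.dL j) × Fin n) (Fin (D.dL j)) ℂ,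
      (∀ j, (V j)ᴴ * V j = 1) ∧
      (∀ j, traceRight (V j * ω j * (V j)ᴴ) = ω j) ∧
      ∀ e : Fin n, W.submatrix (fun a => (a, e)) id * D.U =
        D.U * Matrix.blockDiagonal' (fun j =>
          (V j).submatrix (fun l => (l, e)) id ⊗ₖ (1 : Matrix (Fin (D.dR j)) (Fin (D.dR j)) ℂ))

section Tripartite

variable {R A B : Type} [Fintype R] [DecidableEq R] [Fintype A] [DecidableEq A]
  [Fintype B] [DecidableEq B]

/-- The reduced state `ψ^{RA}`. -/
def reducedRA (ψ : R × A × B → ℂ) : Matrix (R × A) (R × A) ℂ :=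
  fun x y => ∑ b, ψ (x.1, x.2, b) * star (ψ (y.1, y.2, b))

/-- The reduced state `ψ^B`. -/
def reducedB (ψ : R × A × B → ℂ) : Matrix B B ℂ :=
  fun b b' => ∑ r, ∑ a, ψ (r, a, b) * star (ψ (r, a, b'))

/-- The set of the states of `A` that can be steered from `R`, that is, of the operators
`tr_R[(Λ ⊗ 1) ψ^{RA}] / tr[(Λ ⊗ 1) ψ^{RA}]` for `Λ ≥ 0` on `R`. -/
def steeredStates (ψ : R × A × B → ℂ) : Set (Matrix A A ℂ) :=
  {σ | ∃ Λ : Matrix R R ℂ, Λ.PosSemidef ∧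
    ((Λ ⊗ₖ (1 : Matrix A A ℂ)) * reducedRA ψ).trace ≠ 0 ∧
    σ = (((Λ ⊗ₖ (1 : Matrix A A ℂ)) * reducedRA ψ).trace)⁻¹ •
      traceLeft ((Λ ⊗ₖ (1 : Matrix A A ℂ)) * reducedRA ψ)}

/-- The decomposition of the tripartite pure state `ψ` along a decomposition `D` of `A`:
`supp ψ^B = ⨁ j, b_j^L ⊗ b_j^R` and `|ψ⟩ = ⨁ j, √(p j) |ω_j⟩ ⊗ |φ_j⟩` with unit vectors
`|ω_j⟩` in `a_j^L ⊗ b_j^L` and `|φ_j⟩` in `R ⊗ a_j^R ⊗ b_j^R`. -/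
structure TripartiteForm (ψ : R × A × B → ℂ) (D : BlockDecomposition A) where
  dLB : Fin D.J → ℕ
  dRB : Fin D.J → ℕ
  V : Matrix B (Σ j : Fin D.J, Fin (dLB j) × Fin (dRB j)) ℂ
  isometry : Vᴴ * V = 1
  support : LinearMap.range V.mulVecLin = LinearMap.range (reducedB ψ).mulVecLin
  p : Fin D.J → ℝ
  p_nonneg : ∀ j, 0 ≤ p j
  p_sum : ∑ j, p j = 1
  ω : ∀ j, Matrix (Fin (D.dL j)) (Fin (dLB j)) ℂ
  ω_unit : ∀ j, ∑ l, ∑ l', ‖ω j l l'‖ ^ 2 = 1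
  φ : ∀ j, R × Fin (D.dR j) × Fin (dRB j) → ℂ
  φ_unit : ∀ j, ∑ x, ‖φ j x‖ ^ 2 = 1
  decomp : ∀ r a b, ψ (r, a, b) = ∑ j, ((Real.sqrt (p j) : ℝ) : ℂ) *
    ∑ l, ∑ m, ∑ l', ∑ m', D.U a ⟨j, (l, m)⟩ * V b ⟨j, (l', m')⟩ * (ω j l l' * φ j (r, m, m'))

/-- The largest eigenvalue of `ω_j^{a_j^L} = tr_{b_j^L} |ω_j⟩⟨ω_j|`; in terms of the matrix of
coefficients of `|ω_j⟩`, this operator is `ω_j ω_j†`. -/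
def TripartiteForm.lambda0 {ψ : R × A × B → ℂ} {D : BlockDecomposition A}
    (T : TripartiteForm ψ D) (j : Fin D.J) : ℝ :=
  ⨆ i, (Matrix.isHermitian_mul_conjTranspose_self (T.ω j)).eigenvalues i

end Tripartite

end StateMerging

end

/-! The structure of ψ comes from linearity and purification. The operators `⨁ j, ω j ⊗ X j` form a
linear space (`blockEmbed`) containing every steered state. By polarization it contains all blocks
⟨r|ψ^{RA}|r'⟩, so ψ^{RA} itself is `⨁ j, ω j ⊗ X j` with `X j` on R ⊗ a_j^R (`reducedRA_eq`).
Purifying each factor separately gives a purification of ψ^{RA} of the required product form, and an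
isometry on B relates it to ψ (`nonempty_tripartiteForm`).

Merging follows from decoupling. Suppose A has a measurement on A ⊗ ℂ^K with output ℂ^L such that,
for each outcome m, the operator left on R ⊗ ℂ^L is q_m ψ^R ⊗ 1/L. The target state has the same
marginal up to the factor q_m. Two purifications of one operator differ by a partial isometry on B,
so B can restore the target after learning m (`exactMerging_of_decoupling`).

To construct the measurement, use eigenbases of the ω_j. A Kraus operator picks, for each j, an
injection from pairs (basis vector of a_j^R, output l) to pairs (eigenvector of ω_j, basis vector of
ℂ^K), rescales by the inverse root of the eigenvalue, and attaches a sign to each basis vector of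
each a_j^R. Injectivity makes every single outcome decouple (`decouplingKraus_conj`). Averaging over
signs removes the coherences between different (j, b), and correct marginals of the random injection
give completeness (`sum_decouplingKraus`). Birkhoff's theorem supplies such a random injection with
marginals t_j(a)/K exactly when none of its dim a_j^R · L arguments overloads a value, i.e. when
t_j(a) · dim a_j^R · L ≤ K (`exists_injective_sampling`). Hence any rational K/L ≥ max_j λ_0 dim
a_j^R is achievable, and δ only pays for rounding up to a rational. -/

open scoped Matrix Kronecker ComplexOrder

noncomputable section

namespace StateMerging

/-! ### Factorizations and purifications -/

section Factorization

variable {X Z r C : Type} [Fintype X]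
  [Fintype Z] [Fintype r] [DecidableEq r] [Fintype C]

/-- The spectral decomposition of a Hermitian matrix as a product of matrices. -/
theorem isHermitian_eq_mul_diagonal_mul [DecidableEq X] {ρ : Matrix X X ℂ} (hρ : ρ.IsHermitian) :
    ρ = (hρ.eigenvectorUnitary : Matrix X X ℂ) *
      Matrix.diagonal (fun i => (hρ.eigenvalues i : ℂ)) *
        (hρ.eigenvectorUnitary : Matrix X X ℂ)ᴴ := by
  conv_lhs => rw [hρ.spectral_theorem]
  rfl

/-- A positive semidefinite matrix has a factorization `G * Gᴴ` in which `G` has linearly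
independent columns. -/
theorem exists_factorization_of_posSemidef [DecidableEq X] {ρ : Matrix X X ℂ} (hρ : ρ.PosSemidef) :
    ∃ (n : ℕ) (G : Matrix X (Fin n) ℂ) (C : Matrix (Fin n) X ℂ), C * G = 1 ∧ G * Gᴴ = ρ := by
  classical
  set Q : Matrix X X ℂ := (hρ.isHermitian.eigenvectorUnitary : Matrix X X ℂ) with hQ
  set t := hρ.isHermitian.eigenvalues with ht
  have hQQ : Qᴴ * Q = 1 := Unitary.coe_star_mul_self hρ.isHermitian.eigenvectorUnitary
  have ht0 : ∀ i, 0 ≤ t i := hρ.eigenvalues_nonneg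
  -- Keeping only the nonzero eigenvalues makes the columns √t_i · Q_i independent; rescaling the
  -- adjoint rows by t_i^{-1/2} gives the left inverse.
  let S := {i : X // t i ≠ 0}
  let e : S ≃ Fin (Fintype.card S) := Fintype.equivFin S
  have hs : ∀ i : S, ((Real.sqrt (t i) : ℝ) : ℂ) ≠ 0 := fun i => by
    have : 0 < t i := lt_of_le_of_ne (ht0 i) (Ne.symm i.2)
    exact_mod_cast (Real.sqrt_pos.2 this).ne'
  refine ⟨Fintype.card S,
    Matrix.of fun a i => Q a (e.symm i) * (Real.sqrt (t (e.symm i)) : ℝ),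
    Matrix.of fun i a => ((Real.sqrt (t (e.symm i)) : ℝ) : ℂ)⁻¹ * star (Q a (e.symm i)), ?_, ?_⟩
  · ext i j
    have h := congrFun (congrFun hQQ (e.symm i)) (e.symm j)
    simp only [Matrix.mul_apply, Matrix.conjTranspose_apply, Matrix.one_apply, Matrix.of_apply]
      at h ⊢
    have : ∀ a, ((Real.sqrt (t (e.symm i)) : ℝ) : ℂ)⁻¹ * star (Q a (e.symm i)) *
        (Q a (e.symm j) * (Real.sqrt (t (e.symm j)) : ℝ)) =
        ((Real.sqrt (t (e.symm i)) : ℝ) : ℂ)⁻¹ * (Real.sqrt (t (e.symm j)) : ℝ) *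
        (star (Q a (e.symm i)) * Q a (e.symm j)) := fun a => by ring
    simp only [this, ← Finset.mul_sum, h]
    by_cases hij : i = j
    · subst hij
      simp [hs (e.symm i)]
    · have : ((e.symm i : S) : X) ≠ (e.symm j : S) := fun h' =>
        hij (e.symm.injective (Subtype.ext h'))
      simp [hij, this]
  · have hspec := isHermitian_eq_mul_diagonal_mul hρ.isHermitian
    conv_rhs => rw [hspec]
    ext a b
    rw [Matrix.mul_apply, Matrix.mul_apply]
    simp only [Matrix.conjTranspose_apply, Matrix.of_apply, Matrix.mul_diagonal]
    rw [Equiv.sum_comp e.symm (fun i : S => Q a i * ((Real.sqrt (t i) : ℝ) : ℂ) *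
      star (Q b i * ((Real.sqrt (t i) : ℝ) : ℂ)))]
    have h1 : ∀ i : X, Q a i * ((Real.sqrt (t i) : ℝ) : ℂ) *
        star (Q b i * ((Real.sqrt (t i) : ℝ) : ℂ)) = Q a i * (t i : ℂ) * star (Q b i) := fun i => by
      have : ((Real.sqrt (t i) : ℝ) : ℂ) * ((Real.sqrt (t i) : ℝ) : ℂ) = t i := by
        rw [← Complex.ofReal_mul, Real.mul_self_sqrt (ht0 i)]
      rw [star_mul', ← this, show star ((Real.sqrt (t i) : ℝ) : ℂ) = (Real.sqrt (t i) : ℝ) from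
        Complex.conj_ofReal _]
      ring
    simp only [h1]
    refine Fintype.sum_of_injective (Subtype.val : S → X) Subtype.val_injective _ _ ?_
      fun i => rfl
    intro i hi
    have : t i = 0 := by
      by_contra h
      exact hi ⟨⟨i, h⟩, rfl⟩
    show Q a i * (t i : ℂ) * star (Q b i) = 0
    rw [this]
    simp

/-- Two purifications of the same operator are related by an isometry, if one of them has a
reduced state of full rank. -/
theorem exists_isometry_of_mul_conjTranspose_eq [DecidableEq Z]
    {Y : Matrix Z X ℂ} {G : Matrix Z r ℂ}
    {C : Matrix r Z ℂ} (hC : C * G = 1) (h : Y * Yᴴ = G * Gᴴ) :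
    ∃ W : Matrix X r ℂ, Wᴴ * W = 1 ∧ Y = G * Wᴴ := by
  refine ⟨(C * Y)ᴴ, ?_, ?_⟩
  · rw [Matrix.conjTranspose_conjTranspose, Matrix.conjTranspose_mul, Matrix.mul_assoc,
      ← Matrix.mul_assoc Y, h, Matrix.mul_assoc G, ← Matrix.mul_assoc C, hC, Matrix.one_mul,
      ← Matrix.conjTranspose_mul, hC, Matrix.conjTranspose_one]
  · rw [Matrix.conjTranspose_conjTranspose]
    -- `Y` has the same column space as `G`, on which `G * C` acts as the identity; this is checked
    -- through Z Zᴴ = 0 for the difference Z.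
    have h0 : Y - G * (C * Y) = 0 := by
      rw [← Matrix.self_mul_conjTranspose_eq_zero]
      have h1 : Y - G * (C * Y) = (1 - G * C) * Y := by
        rw [Matrix.sub_mul, Matrix.one_mul, Matrix.mul_assoc]
      have h2 : (1 - G * C) * G = 0 := by
        rw [Matrix.sub_mul, Matrix.one_mul, Matrix.mul_assoc, hC, Matrix.mul_one, sub_self]
      rw [h1, Matrix.conjTranspose_mul, Matrix.mul_assoc, ← Matrix.mul_assoc Y, h,
        Matrix.mul_assoc G, ← Matrix.mul_assoc _ G, h2, Matrix.zero_mul]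
    exact sub_eq_zero.1 h0

/-- Two purifications of the same operator are related by a partial isometry. -/
theorem exists_partialIsometry_of_mul_conjTranspose_eq [DecidableEq Z]
    {Y : Matrix Z X ℂ} {Y' : Matrix Z C ℂ}
    (h : Y * Yᴴ = Y' * Y'ᴴ) :
    ∃ T : Matrix X C ℂ, Y * T = Y' ∧ Y * (T * Tᴴ) = Y ∧ T * Tᴴ * (T * Tᴴ) = T * Tᴴ := by
  obtain ⟨n, G, C', hC, hG⟩ :=
    exists_factorization_of_posSemidef (Matrix.posSemidef_self_mul_conjTranspose Y)
  obtain ⟨W, hW, hY⟩ := exists_isometry_of_mul_conjTranspose_eq hC hG.symm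
  obtain ⟨W', hW', hY'⟩ := exists_isometry_of_mul_conjTranspose_eq hC (h.symm.trans hG.symm)
  have hT : W * W'ᴴ * (W * W'ᴴ)ᴴ = W * Wᴴ := by
    rw [Matrix.conjTranspose_mul, Matrix.conjTranspose_conjTranspose, Matrix.mul_assoc W,
      ← Matrix.mul_assoc W'ᴴ, hW', Matrix.one_mul]
  -- Both purifications pass through the minimal one `G`: undo the isometry of `Y`, then apply that
  -- of `Y'`. No comparison of the dimensions of `X` and `C` is needed.
  refine ⟨W * W'ᴴ, ?_, ?_, ?_⟩
  · rw [hY', ← Matrix.mul_assoc, hY, Matrix.mul_assoc G, hW, Matrix.mul_one]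
  · rw [hT, hY, Matrix.mul_assoc G, ← Matrix.mul_assoc Wᴴ, hW, Matrix.one_mul]
  · rw [hT, Matrix.mul_assoc W, ← Matrix.mul_assoc Wᴴ, hW, Matrix.one_mul]

/-- Kraus operators whose completeness relation is an orthogonal projection are completed to a
measurement by Kraus operators that factor through the complementary projection. -/
theorem sum_single_mul_compl_projection [DecidableEq C] [DecidableEq X]
    {P : Matrix X X ℂ} (hP : Pᴴ = P)
    (hPP : P * P = P) (c : C) :
    ∑ x : X, (Matrix.single c x (1 : ℂ) * (1 - P))ᴴ * (Matrix.single c x (1 : ℂ) * (1 - P)) =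
      1 - P := by
  have h1 : (1 - P)ᴴ = 1 - P := by
    rw [Matrix.conjTranspose_sub, Matrix.conjTranspose_one, hP]
  have h2 : ∀ x : X, (Matrix.single c x (1 : ℂ) * (1 - P))ᴴ * (Matrix.single c x (1 : ℂ) * (1 - P))
      = (1 - P) * Matrix.single x x 1 * (1 - P) := fun x => by
    rw [Matrix.conjTranspose_mul, h1, Matrix.conjTranspose_single, Matrix.mul_assoc,
      ← Matrix.mul_assoc (Matrix.single x c _), Matrix.single_mul_single_same]
    simp [Matrix.mul_assoc]
  have h3 : ∑ x : X, Matrix.single x x (1 : ℂ) = 1 := by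
    ext a b
    by_cases hab : a = b
    · subst hab; simp [Matrix.sum_apply, Matrix.single_apply]
    · simp only [Matrix.sum_apply, Matrix.single_apply, Matrix.one_apply_ne hab]
      exact Finset.sum_eq_zero fun x _ => if_neg fun h => hab (h.1.symm.trans h.2)
  rw [Finset.sum_congr rfl fun x _ => h2 x, ← Finset.sum_mul, ← Finset.mul_sum, h3,
    Matrix.mul_one, Matrix.sub_mul, Matrix.one_mul, Matrix.mul_sub, hPP, Matrix.mul_one, sub_self,
    sub_zero]

/-- The range of `V * P * Vᴴ` for an isometry `V` and an invertible `P`. -/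
theorem range_mulVecLin_isometry_conj [DecidableEq X]
    {V : Matrix Z X ℂ} (hV : Vᴴ * V = 1) {P P' : Matrix X X ℂ}
    (hP : P * P' = 1) :
    LinearMap.range (V * P * Vᴴ).mulVecLin = LinearMap.range V.mulVecLin := by
  apply le_antisymm
  · rintro _ ⟨x, rfl⟩
    exact ⟨(P * Vᴴ).mulVec x, by simp [Matrix.mulVec_mulVec, Matrix.mul_assoc]⟩
  · rintro _ ⟨x, rfl⟩
    refine ⟨(V * P').mulVec x, ?_⟩
    have : V * P * Vᴴ * (V * P') = V := by
      rw [Matrix.mul_assoc, ← Matrix.mul_assoc Vᴴ, hV, Matrix.one_mul, Matrix.mul_assoc, hP,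
        Matrix.mul_one]
    simp only [Matrix.mulVecLin_apply, Matrix.mulVec_mulVec, this]

/-- The Gram matrix of a matrix with a left inverse has a right inverse. -/
theorem exists_gram_mul_eq_one {G : Matrix Z r ℂ} {C : Matrix r Z ℂ} (hC : C * G = 1) :
    ∃ P' : Matrix r r ℂ, Gᴴ * G * P' = 1 := by
  have h : IsUnit (Gᴴ * G) := by
    rw [← Matrix.mulVec_injective_iff_isUnit]
    intro x y hxy
    have h0 : (Gᴴ * G).mulVec (x - y) = 0 := by
      rw [Matrix.mulVec_sub]; exact sub_eq_zero.2 hxy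
    rw [Matrix.conjTranspose_mul_self_mulVec_eq_zero] at h0
    have h1 := congrArg C.mulVec h0
    rw [Matrix.mulVec_mulVec, hC, Matrix.one_mulVec, Matrix.mulVec_zero] at h1
    exact sub_eq_zero.1 h1
  obtain ⟨u, hu⟩ := h
  exact ⟨(u⁻¹ : (Matrix r r ℂ)ˣ), by rw [← hu, Units.mul_inv]⟩

end Factorization

/-! ### Block form of the reduced states -/

section BlockForm

variable {R A B : Type} [Fintype R] [DecidableEq R] [Fintype A] [DecidableEq A]
  [Fintype B]

/-- The vector `ψ` as an operator from `B` to `R ⊗ A`. -/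
def amplitude (ψ : R × A × B → ℂ) : Matrix (R × A) B ℂ :=
  Matrix.of fun x b => ψ (x.1, x.2, b)

omit [Fintype R] [DecidableEq R] [Fintype A] [DecidableEq A] in
theorem reducedRA_eq_amplitude_mul (ψ : R × A × B → ℂ) :
    reducedRA ψ = amplitude ψ * (amplitude ψ)ᴴ := rfl

omit [DecidableEq R] [DecidableEq A] [Fintype B] in
theorem reducedB_eq_amplitude_mul (ψ : R × A × B → ℂ) :
    reducedB ψ = (amplitude ψ)ᵀ * (amplitude ψ)ᵀᴴ := by
  ext b b'
  simp [reducedB, amplitude, Matrix.mul_apply, Fintype.sum_prod_type]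

/-- The block `⟨r| Z |r'⟩` of an operator on `R ⊗ X`. -/
def block {X : Type} (Z : Matrix (R × X) (R × X) ℂ) (r r' : R) : Matrix X X ℂ :=
  Z.submatrix (Prod.mk r) (Prod.mk r')

/-- The identification `R ⊗ ⨁ j, a_j^L ⊗ a_j^R = ⨁ j, a_j^L ⊗ (R ⊗ a_j^R)`. -/
def regroup (R : Type) (D : BlockDecomposition A) :
    R × (Σ j, Fin (D.dL j) × Fin (D.dR j)) ≃ Σ j, Fin (D.dL j) × (R × Fin (D.dR j)) where
  toFun x := ⟨x.2.1, x.2.2.1, x.1, x.2.2.2⟩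
  invFun x := ⟨x.2.2.1, x.1, x.2.1, x.2.2.2⟩
  left_inv _ := rfl
  right_inv _ := rfl

omit [Fintype R] [DecidableEq R] [DecidableEq A] in
theorem block_blockDiagonal'_regroup (D : BlockDecomposition A)
    (ω : ∀ j, Matrix (Fin (D.dL j)) (Fin (D.dL j)) ℂ)
    (X : ∀ j, Matrix (R × Fin (D.dR j)) (R × Fin (D.dR j)) ℂ) (r r' : R) :
    block ((Matrix.blockDiagonal' fun j => ω j ⊗ₖ X j).submatrix (regroup R D) (regroup R D)) r r' =
      Matrix.blockDiagonal' fun j => ω j ⊗ₖ block (X j) r r' := by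
  ext ⟨j, x⟩ ⟨j', x'⟩
  by_cases h : j = j'
  · subst h
    simp [block, regroup, Matrix.blockDiagonal'_apply]
  · simp [block, regroup, Matrix.blockDiagonal'_apply, h]

theorem block_one_kronecker_conj {X Y : Type} [Fintype Y] (V : Matrix X Y ℂ)
    (Z : Matrix (R × Y) (R × Y) ℂ) (r r' : R) :
    block (((1 : Matrix R R ℂ) ⊗ₖ V) * Z * ((1 : Matrix R R ℂ) ⊗ₖ V)ᴴ) r r' =
      V * block Z r r' * Vᴴ := by
  ext a a'
  simp [block, Matrix.mul_apply, Fintype.sum_prod_type, Matrix.one_apply, ite_mul,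
    Finset.sum_ite_eq, apply_ite]

omit [Fintype R] [DecidableEq R] in
theorem ext_block {X : Type} {Z Z' : Matrix (R × X) (R × X) ℂ}
    (h : ∀ r r', block Z r r' = block Z' r r') : Z = Z' := by
  ext ⟨r, a⟩ ⟨r', a'⟩
  exact congrFun (congrFun (h r r') a) a'

/-- The unnormalized state of `A` that is steered by an operator on `R`. -/
def steer (ψ : R × A × B → ℂ) : Matrix R R ℂ →ₗ[ℂ] Matrix A A ℂ where
  toFun Λ := traceLeft ((Λ ⊗ₖ (1 : Matrix A A ℂ)) * reducedRA ψ)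
  map_add' Λ Λ' := by
    ext a a'
    simp [traceLeft, Matrix.add_kronecker, Matrix.add_mul, Finset.sum_add_distrib]
  map_smul' c Λ := by
    ext a a'
    simp [traceLeft, Matrix.smul_kronecker, Finset.mul_sum]

/-- Off-diagonal blocks of ψ^{RA} are values of the linear map `steer` at operators that are not
positive; this is what allows linear extension from the steered states. -/
theorem steer_single (ψ : R × A × B → ℂ) (r r' : R) :
    steer ψ (Matrix.single r' r 1) = block (reducedRA ψ) r r' := by
  ext a a'
  simp only [steer, LinearMap.coe_mk, AddHom.coe_mk, traceLeft, block, Matrix.submatrix_apply,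
    Matrix.mul_apply, Fintype.sum_prod_type, Matrix.kroneckerMap_apply, Matrix.single_apply,
    Matrix.one_apply]
  rw [Finset.sum_eq_single r' (fun b _ hb => by simp [Ne.symm hb]) (by simp),
    Finset.sum_eq_single r (fun b _ hb => by simp [Ne.symm hb]) (by simp)]
  simp

theorem trace_steer (ψ : R × A × B → ℂ) (Λ : Matrix R R ℂ) :
    (steer ψ Λ).trace = ((Λ ⊗ₖ (1 : Matrix A A ℂ)) * reducedRA ψ).trace := by
  simp only [steer, LinearMap.coe_mk, AddHom.coe_mk, traceLeft, Matrix.trace, Matrix.diag,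
    Fintype.sum_prod_type]
  exact Finset.sum_comm

omit [DecidableEq R] [DecidableEq A] in
theorem trace_reducedRA {ψ : R × A × B → ℂ} (hψ : ∑ x, ‖ψ x‖ ^ 2 = 1) :
    (reducedRA ψ).trace = 1 := by
  have h : ∀ z : ℂ, z * star z = ((‖z‖ ^ 2 : ℝ) : ℂ) := fun z => by
    rw [Complex.star_def, Complex.mul_conj, Complex.normSq_eq_norm_sq]
  simp only [Fintype.sum_prod_type] at hψ
  simp only [Matrix.trace, Matrix.diag, reducedRA, Fintype.sum_prod_type, h]
  exact_mod_cast hψ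

theorem trace_steer_one {ψ : R × A × B → ℂ} (hψ : ∑ x, ‖ψ x‖ ^ 2 = 1) :
    (steer ψ 1).trace = 1 := by
  rw [trace_steer, Matrix.one_kronecker_one, Matrix.one_mul, trace_reducedRA hψ]

omit [Fintype R] in
/-- A rank-one operator is a combination of positive semidefinite ones. -/
theorem single_eq_polarization (r r' : R) :
    Matrix.single r r' (1 : ℂ) = (1 / 4 : ℂ) • ∑ k : Fin 4, Complex.I ^ (k : ℕ) •
      Matrix.vecMulVec (Pi.single r 1 + Complex.I ^ (k : ℕ) • Pi.single r' 1)
        (star (Pi.single r 1 + Complex.I ^ (k : ℕ) • Pi.single r' 1)) := by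
  have h3 : Complex.I ^ 3 = -Complex.I := Complex.I_pow_three
  have hI : star Complex.I = -Complex.I := Complex.conj_I
  have h0 : Matrix.single r r' (1 : ℂ) =
      Matrix.vecMulVec (Pi.single r 1) (star (Pi.single r' (1 : ℂ))) := by
    ext x y
    rcases eq_or_ne x r with rfl | hx <;> rcases eq_or_ne y r' with rfl | hy <;>
      simp [Matrix.vecMulVec_apply, *, Ne.symm]
  rw [h0]
  ext x y
  simp only [Fin.sum_univ_four, Matrix.smul_apply, Matrix.add_apply, Matrix.vecMulVec_apply,
    Pi.add_apply, Pi.star_apply, Pi.smul_apply, smul_eq_mul, star_add, star_mul']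
  generalize (Pi.single r 1 : R → ℂ) x = a
  generalize (Pi.single r' 1 : R → ℂ) x = b
  generalize star ((Pi.single r 1 : R → ℂ) y) = c
  generalize star ((Pi.single r' 1 : R → ℂ) y) = d
  simp only [Fin.val_zero, Fin.val_one, Fin.val_two, show ((3 : Fin 4) : ℕ) = 3 from rfl, pow_zero,
    pow_one, Complex.I_sq, h3, star_one, star_neg, hI]
  have h2 : Complex.I * Complex.I = -1 := Complex.I_mul_I
  linear_combination (exp := 1) (a * d * (1 / 2) - b * c * (1 / 2)) * h2

/-- The operators `⨁ j, ω j ⊗ X j` on the decomposed space. -/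
def blockEmbed (D : BlockDecomposition A) (ω : ∀ j, Matrix (Fin (D.dL j)) (Fin (D.dL j)) ℂ) :
    (∀ j, Matrix (Fin (D.dR j)) (Fin (D.dR j)) ℂ) →ₗ[ℂ] Matrix A A ℂ where
  toFun X := D.U * (Matrix.blockDiagonal' fun j => ω j ⊗ₖ X j) * D.Uᴴ
  map_add' X X' := by
    have : (Matrix.blockDiagonal' fun j => ω j ⊗ₖ (X + X') j) =
        (Matrix.blockDiagonal' fun j => ω j ⊗ₖ X j) +
          (Matrix.blockDiagonal' fun j => ω j ⊗ₖ X' j) := by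
      rw [← Matrix.blockDiagonal'_add]
      congr 1
      funext j
      exact Matrix.kronecker_add _ _ _
    rw [this, Matrix.mul_add, Matrix.add_mul]
  map_smul' c X := by
    have : (Matrix.blockDiagonal' fun j => ω j ⊗ₖ (c • X) j) =
        c • (Matrix.blockDiagonal' fun j => ω j ⊗ₖ X j) := by
      rw [← Matrix.blockDiagonal'_smul]
      congr 1
      funext j
      simp [Matrix.kronecker_smul]
    rw [this, Matrix.mul_smul, Matrix.smul_mul, RingHom.id_apply]

omit [Fintype B] [DecidableEq A] in
theorem conjTranspose_mul_blockEmbed_mul (D : BlockDecomposition A)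
    (ω : ∀ j, Matrix (Fin (D.dL j)) (Fin (D.dL j)) ℂ)
    (X : ∀ j, Matrix (Fin (D.dR j)) (Fin (D.dR j)) ℂ) :
    D.Uᴴ * blockEmbed D ω X * D.U = Matrix.blockDiagonal' fun j => ω j ⊗ₖ X j := by
  simp only [blockEmbed, LinearMap.coe_mk, AddHom.coe_mk]
  rw [Matrix.mul_assoc, Matrix.mul_assoc _ D.Uᴴ, D.isometry, Matrix.mul_one, ← Matrix.mul_assoc,
    D.isometry, Matrix.one_mul]

variable {ψ : R × A × B → ℂ} {D : BlockDecomposition A}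
  {ω : ∀ j, Matrix (Fin (D.dL j)) (Fin (D.dL j)) ℂ}

theorem steer_mem_of_trace_ne_zero (hD : IsKoashiImoto (steeredStates ψ) D ω) {Λ : Matrix R R ℂ}
    (hΛ : Λ.PosSemidef) (h : (steer ψ Λ).trace ≠ 0) :
    steer ψ Λ ∈ LinearMap.range (blockEmbed D ω) := by
  have ht := h
  rw [trace_steer] at h
  obtain ⟨q, φ, -, -, -, hρ⟩ := hD.form _ ⟨Λ, hΛ, h, rfl⟩
  have h1 : ((steer ψ Λ).trace)⁻¹ • steer ψ Λ = blockEmbed D ω fun j => (q j : ℂ) • φ j := by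
    rw [trace_steer]
    refine hρ.trans ?_
    simp only [blockEmbed, LinearMap.coe_mk, AddHom.coe_mk]
    congr 3
    funext j
    exact (Matrix.kronecker_smul _ _ _).symm
  refine ⟨(steer ψ Λ).trace • fun j => (q j : ℂ) • φ j, ?_⟩
  rw [map_smul, ← h1, smul_smul, mul_inv_cancel₀ ht, one_smul]

/-- When the trace vanishes there is no normalized steered state to appeal to; Λ is then written as
(Λ + 1) − 1, both of which steer with trace 1. -/
theorem steer_mem_of_posSemidef (hψ : ∑ x, ‖ψ x‖ ^ 2 = 1)
    (hD : IsKoashiImoto (steeredStates ψ) D ω) {Λ : Matrix R R ℂ} (hΛ : Λ.PosSemidef) :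
    steer ψ Λ ∈ LinearMap.range (blockEmbed D ω) := by
  by_cases h : (steer ψ Λ).trace = 0
  · have h1 : steer ψ 1 ∈ LinearMap.range (blockEmbed D ω) :=
      steer_mem_of_trace_ne_zero hD Matrix.PosSemidef.one (by simp [trace_steer_one hψ])
    have h2 : steer ψ (Λ + 1) ∈ LinearMap.range (blockEmbed D ω) := by
      apply steer_mem_of_trace_ne_zero hD (hΛ.add Matrix.PosSemidef.one)
      rw [map_add, Matrix.trace_add, h, trace_steer_one hψ]
      simp
    have h3 := Submodule.sub_mem _ h2 h1
    rwa [map_add, add_sub_cancel_right] at h3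
  · exact steer_mem_of_trace_ne_zero hD hΛ h

theorem block_reducedRA_mem (hψ : ∑ x, ‖ψ x‖ ^ 2 = 1)
    (hD : IsKoashiImoto (steeredStates ψ) D ω) (r r' : R) :
    block (reducedRA ψ) r r' ∈ LinearMap.range (blockEmbed D ω) := by
  rw [← steer_single, single_eq_polarization, map_smul, map_sum]
  refine Submodule.smul_mem _ _ (Submodule.sum_mem _ fun k _ => ?_)
  rw [map_smul]
  exact Submodule.smul_mem _ _
    (steer_mem_of_posSemidef hψ hD (Matrix.posSemidef_vecMulVec_self_star _))

/-- The operator from `a_j^L ⊗ B` to `R ⊗ a_j^R` given by the block `j` of `ψ`. -/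
def blockAmplitude (ψ : R × A × B → ℂ) (D : BlockDecomposition A) (j : Fin D.J) :
    Matrix (R × Fin (D.dR j)) (Fin (D.dL j) × B) ℂ :=
  Matrix.of fun x y => ∑ a, star (D.U a ⟨j, (y.1, x.2)⟩) * ψ (x.1, a, y.2)

/-- The unnormalized state of `R ⊗ a_j^R`. -/
def blockState (ψ : R × A × B → ℂ) (D : BlockDecomposition A) (j : Fin D.J) :
    Matrix (R × Fin (D.dR j)) (R × Fin (D.dR j)) ℂ :=
  blockAmplitude ψ D j * (blockAmplitude ψ D j)ᴴ

omit [DecidableEq A] [DecidableEq R] [Fintype R] in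
theorem block_blockState_apply (j : Fin D.J) (r r' : R) (y y' : Fin (D.dR j)) :
    block (blockState ψ D j) r r' y y' =
      ∑ x, (D.Uᴴ * block (reducedRA ψ) r r' * D.U) ⟨j, (x, y)⟩ ⟨j, (x, y')⟩ := by
  simp only [block, blockState, blockAmplitude, Matrix.mul_apply, Matrix.submatrix_apply,
    Fintype.sum_prod_type, Matrix.conjTranspose_apply, Matrix.of_apply, reducedRA, star_sum,
    star_mul', star_star]
  refine Finset.sum_congr rfl fun x _ => ?_
  simp only [Finset.sum_mul, Finset.mul_sum]
  rw [Finset.sum_comm]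
  refine (Finset.sum_congr rfl fun a _ => Finset.sum_comm).trans ?_
  refine Finset.sum_congr rfl fun a _ => Finset.sum_congr rfl fun a' _ =>
    Finset.sum_congr rfl fun b _ => ?_
  ring

/-- Since tr ω_j = 1, the coefficient of ω_j is recovered by tracing out a_j^L. This identifies the
coefficients for all r, r' as the blocks of one positive operator on R ⊗ a_j^R. -/
theorem block_reducedRA_eq (hψ : ∑ x, ‖ψ x‖ ^ 2 = 1)
    (hD : IsKoashiImoto (steeredStates ψ) D ω) (r r' : R) :
    block (reducedRA ψ) r r' = blockEmbed D ω fun j => block (blockState ψ D j) r r' := by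
  obtain ⟨X, hX⟩ := block_reducedRA_mem hψ hD r r'
  rw [← hX]
  congr 1
  funext j
  ext y y'
  have h1 : ∑ x, ω j x x = 1 := (hD.state j).2
  rw [block_blockState_apply, ← hX, conjTranspose_mul_blockEmbed_mul]
  simp [Matrix.blockDiagonal'_apply, ← Finset.sum_mul, h1]

theorem reducedRA_eq (hψ : ∑ x, ‖ψ x‖ ^ 2 = 1) (hD : IsKoashiImoto (steeredStates ψ) D ω) :
    reducedRA ψ = ((1 : Matrix R R ℂ) ⊗ₖ D.U) *
      (Matrix.blockDiagonal' fun j => ω j ⊗ₖ blockState ψ D j).submatrix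
        (regroup R D) (regroup R D) * ((1 : Matrix R R ℂ) ⊗ₖ D.U)ᴴ := by
  refine ext_block fun r r' => ?_
  rw [block_one_kronecker_conj, block_blockDiagonal'_regroup, block_reducedRA_eq hψ hD]
  rfl

/-- If block j carried no weight, every steered state would be orthogonal to it, whereas the steered
states jointly span the range of `D.U`, which contains the nonzero block j. -/
theorem blockState_ne_zero (hψ : ∑ x, ‖ψ x‖ ^ 2 = 1)
    (hD : IsKoashiImoto (steeredStates ψ) D ω) (j : Fin D.J) : blockState ψ D j ≠ 0 := by
  intro h0
  set i : Σ j, Fin (D.dL j) × Fin (D.dR j) := ⟨j, (⟨0, D.dL_pos j⟩, ⟨0, D.dR_pos j⟩)⟩ with hi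
  have hblock : ∀ r r' b, (D.Uᴴ * block (reducedRA ψ) r r') i b = 0 := fun r r' b => by
    rw [block_reducedRA_eq hψ hD]
    simp only [blockEmbed, LinearMap.coe_mk, AddHom.coe_mk]
    rw [← Matrix.mul_assoc, ← Matrix.mul_assoc, D.isometry, Matrix.one_mul, Matrix.mul_apply]
    refine Finset.sum_eq_zero fun x _ => ?_
    obtain ⟨j', x⟩ := x
    have : (Matrix.blockDiagonal' fun j => ω j ⊗ₖ block (blockState ψ D j) r r') i ⟨j', x⟩ = 0 := by
      by_cases hj : j = j'
      · subst hj
        simp [hi, Matrix.blockDiagonal'_apply, block, h0]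
      · simp [hi, Matrix.blockDiagonal'_apply, hj]
    rw [this, zero_mul]
  have hsteer : ∀ Λ b, (D.Uᴴ * steer ψ Λ) i b = 0 := fun Λ b => by
    rw [Matrix.matrix_eq_sum_single Λ]
    simp only [map_sum, Matrix.mul_sum, Matrix.sum_apply]
    refine Finset.sum_eq_zero fun r _ => Finset.sum_eq_zero fun r' _ => ?_
    have : Matrix.single r r' (Λ r r') = Λ r r' • Matrix.single r r' 1 := by simp
    rw [this, map_smul, Matrix.mul_smul, Matrix.smul_apply, steer_single, hblock, smul_zero]
  have hle : LinearMap.range D.U.mulVecLin ≤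
      LinearMap.ker ((LinearMap.proj i : (_ → ℂ) →ₗ[ℂ] ℂ) ∘ₗ D.Uᴴ.mulVecLin) := by
    rw [hD.support]
    refine iSup₂_le fun ρ hρ => ?_
    obtain ⟨Λ, -, -, rfl⟩ := hρ
    rintro _ ⟨v, rfl⟩
    rw [LinearMap.mem_ker]
    have h1 : ∀ c : ℂ, (D.Uᴴ * (c • steer ψ Λ)).mulVec v i = 0 := fun c => by
      refine Finset.sum_eq_zero fun b _ => ?_
      show (D.Uᴴ * (c • steer ψ Λ)) i b * v b = 0
      rw [Matrix.mul_smul, Matrix.smul_apply, hsteer, smul_zero, zero_mul]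
    have h2 := h1 ((Λ ⊗ₖ (1 : Matrix A A ℂ)) * reducedRA ψ).trace⁻¹
    rw [← Matrix.mulVec_mulVec] at h2
    exact h2
  have hmem := hle ⟨Pi.single i 1, rfl⟩
  rw [LinearMap.mem_ker] at hmem
  simp only [LinearMap.comp_apply, Matrix.mulVecLin_apply, Matrix.mulVec_mulVec, D.isometry,
    Matrix.one_mulVec, LinearMap.proj_apply, Pi.single_eq_same] at hmem
  exact one_ne_zero hmem

end BlockForm

/-! ### Existence of the tripartite decomposition -/

section TripartiteDecomposition

variable {R A B : Type} [Fintype R] [DecidableEq R] [Fintype A] [Fintype B]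

omit [DecidableEq R] [Fintype R] [Fintype A] [Fintype B] in
theorem trace_mul_conjTranspose_eq_sum {X Y : Type} [Fintype X] [Fintype Y] (G : Matrix X Y ℂ) :
    (G * Gᴴ).trace = ((∑ x, ∑ y, ‖G x y‖ ^ 2 : ℝ) : ℂ) := by
  have h : ∀ z : ℂ, z * star z = ((‖z‖ ^ 2 : ℝ) : ℂ) := fun z => by
    rw [Complex.star_def, Complex.mul_conj, Complex.normSq_eq_norm_sq]
  simp only [Matrix.trace, Matrix.diag, Matrix.mul_apply, Matrix.conjTranspose_apply, h]
  push_cast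
  rfl

/-- The purification `⨁ j, |G j⟩ ⊗ |H j⟩` of a block diagonal operator on `R ⊗ A`. -/
def blockPurification (D : BlockDecomposition A) {dLB dRB : Fin D.J → ℕ}
    (G : ∀ j, Matrix (Fin (D.dL j)) (Fin (dLB j)) ℂ)
    (H : ∀ j, Matrix (R × Fin (D.dR j)) (Fin (dRB j)) ℂ) :
    Matrix (R × A) (Σ j, Fin (dLB j) × Fin (dRB j)) ℂ :=
  ((1 : Matrix R R ℂ) ⊗ₖ D.U) *
    (Matrix.blockDiagonal' fun j => G j ⊗ₖ H j).submatrix (regroup R D) id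

omit [Fintype B] in
theorem blockPurification_mul_apply (D : BlockDecomposition A) {dLB dRB : Fin D.J → ℕ}
    (G : ∀ j, Matrix (Fin (D.dL j)) (Fin (dLB j)) ℂ)
    (H : ∀ j, Matrix (R × Fin (D.dR j)) (Fin (dRB j)) ℂ)
    (N : Matrix (Σ j, Fin (dLB j) × Fin (dRB j)) B ℂ) (r : R) (a : A) (b : B) :
    (blockPurification D G H * N) (r, a) b = ∑ j, ∑ l, ∑ m, ∑ l', ∑ m',
      D.U a ⟨j, (l, m)⟩ * N ⟨j, (l', m')⟩ b * (G j l l' * H j (r, m) m') := by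
  have h : ∀ j l' m', blockPurification D G H (r, a) ⟨j, (l', m')⟩ =
      ∑ l, ∑ m, D.U a ⟨j, (l, m)⟩ * (G j l l' * H j (r, m) m') := fun j l' m' => by
    simp only [blockPurification, Matrix.mul_apply, Fintype.sum_prod_type, Fintype.sum_sigma,
      Matrix.kroneckerMap_apply, Matrix.submatrix_apply, regroup, Equiv.coe_fn_mk, id,
      Matrix.one_apply]
    rw [Finset.sum_eq_single r (fun r' _ hr => by simp [Ne.symm hr]) (by simp),
      Finset.sum_eq_single j (fun j' _ hj => by simp [Matrix.blockDiagonal'_apply, hj]) (by simp)]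
    simp [Matrix.blockDiagonal'_apply]
  simp only [Matrix.mul_apply, Fintype.sum_sigma, Fintype.sum_prod_type, h, Finset.sum_mul]
  refine Finset.sum_congr rfl fun j _ => ?_
  calc _ = ∑ l', ∑ l, ∑ m', ∑ m, _ := Finset.sum_congr rfl fun l' _ => Finset.sum_comm
    _ = ∑ l, ∑ l', ∑ m', ∑ m, _ := Finset.sum_comm
    _ = ∑ l, ∑ l', ∑ m, ∑ m', _ :=
      Finset.sum_congr rfl fun l _ => Finset.sum_congr rfl fun l' _ => Finset.sum_comm
    _ = ∑ l, ∑ m, ∑ l', ∑ m', _ := Finset.sum_congr rfl fun l _ => Finset.sum_comm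
  refine Finset.sum_congr rfl fun l _ => Finset.sum_congr rfl fun m _ =>
    Finset.sum_congr rfl fun l' _ => Finset.sum_congr rfl fun m' _ => ?_
  ring

theorem blockPurification_mul_conjTranspose (D : BlockDecomposition A) {dLB dRB : Fin D.J → ℕ}
    (G : ∀ j, Matrix (Fin (D.dL j)) (Fin (dLB j)) ℂ)
    (H : ∀ j, Matrix (R × Fin (D.dR j)) (Fin (dRB j)) ℂ) :
    blockPurification D G H * (blockPurification D G H)ᴴ =
      ((1 : Matrix R R ℂ) ⊗ₖ D.U) *
        (Matrix.blockDiagonal' fun j => (G j * (G j)ᴴ) ⊗ₖ (H j * (H j)ᴴ)).submatrix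
          (regroup R D) (regroup R D) * ((1 : Matrix R R ℂ) ⊗ₖ D.U)ᴴ := by
  simp only [blockPurification, Matrix.conjTranspose_mul, Matrix.conjTranspose_submatrix,
    Matrix.blockDiagonal'_conjTranspose, Matrix.mul_kronecker_mul, Matrix.conjTranspose_kronecker,
    Matrix.blockDiagonal'_mul]
  simp only [Matrix.mul_assoc]
  congr 1
  simp only [← Matrix.mul_assoc]
  rw [Matrix.submatrix_mul _ _ _ id _ Function.bijective_id]

theorem one_kronecker_isometry (D : BlockDecomposition A) :
    ((1 : Matrix R R ℂ) ⊗ₖ D.U)ᴴ * ((1 : Matrix R R ℂ) ⊗ₖ D.U) = 1 := by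
  rw [Matrix.conjTranspose_kronecker, ← Matrix.mul_kronecker_mul, D.isometry,
    Matrix.conjTranspose_one, Matrix.one_mul, Matrix.one_kronecker_one]

/-- Minimality of the block purification: it has full rank on the purifying side, which yields both
the isometry into B and the equality of its range with supp ψ^B. -/
theorem exists_leftInverse_blockPurification (D : BlockDecomposition A) {dLB dRB : Fin D.J → ℕ}
    {G : ∀ j, Matrix (Fin (D.dL j)) (Fin (dLB j)) ℂ}
    {H : ∀ j, Matrix (R × Fin (D.dR j)) (Fin (dRB j)) ℂ}
    {CG : ∀ j, Matrix (Fin (dLB j)) (Fin (D.dL j)) ℂ}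
    {CH : ∀ j, Matrix (Fin (dRB j)) (R × Fin (D.dR j)) ℂ}
    (hG : ∀ j, CG j * G j = 1) (hH : ∀ j, CH j * H j = 1) :
    ∃ C : Matrix (Σ j, Fin (dLB j) × Fin (dRB j)) (R × A) ℂ, C * blockPurification D G H = 1 := by
  refine ⟨(Matrix.blockDiagonal' fun j => CG j ⊗ₖ CH j).submatrix id (regroup R D) *
    ((1 : Matrix R R ℂ) ⊗ₖ D.U)ᴴ, ?_⟩
  rw [blockPurification, Matrix.mul_assoc, ← Matrix.mul_assoc _ _ (Matrix.submatrix _ _ _),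
    one_kronecker_isometry, Matrix.one_mul, Matrix.submatrix_mul_equiv, ← Matrix.blockDiagonal'_mul]
  simp only [← Matrix.mul_kronecker_mul, hG, hH, Matrix.one_kronecker_one]
  exact Matrix.blockDiagonal'_one

variable [DecidableEq A] {ψ : R × A × B → ℂ} {D : BlockDecomposition A}
  {ω : ∀ j, Matrix (Fin (D.dL j)) (Fin (D.dL j)) ℂ}

theorem sum_trace_blockState (hψ : ∑ x, ‖ψ x‖ ^ 2 = 1)
    (hD : IsKoashiImoto (steeredStates ψ) D ω) : ∑ j, (blockState ψ D j).trace = 1 := by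
  rw [← trace_reducedRA hψ, reducedRA_eq hψ hD, Matrix.trace_mul_comm, ← Matrix.mul_assoc,
    one_kronecker_isometry, Matrix.one_mul]
  have h : ∀ Z : Matrix (Σ j, Fin (D.dL j) × (R × Fin (D.dR j)))
      (Σ j, Fin (D.dL j) × (R × Fin (D.dR j))) ℂ,
      (Z.submatrix (regroup R D) (regroup R D)).trace = Z.trace := fun Z =>
    Equiv.sum_comp (regroup R D) fun i => Z i i
  rw [h, Matrix.trace_blockDiagonal']
  exact Finset.sum_congr rfl fun j _ => by rw [Matrix.trace_kronecker, (hD.state j).2, one_mul]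

theorem nonempty_tripartiteForm (hψ : ∑ x, ‖ψ x‖ ^ 2 = 1)
    (hD : IsKoashiImoto (steeredStates ψ) D ω) : Nonempty (TripartiteForm ψ D) := by
  choose dLB G CG hCG hG using fun j => exists_factorization_of_posSemidef (hD.state j).1
  choose dRB H CH hCH hH using fun j => exists_factorization_of_posSemidef
    (Matrix.posSemidef_self_mul_conjTranspose (blockAmplitude ψ D j))
  change ∀ j, H j * (H j)ᴴ = blockState ψ D j at hH
  obtain ⟨C, hC⟩ := exists_leftInverse_blockPurification D hCG hCH
  have hΨ : amplitude ψ * (amplitude ψ)ᴴ =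
      blockPurification D G H * (blockPurification D G H)ᴴ := by
    rw [blockPurification_mul_conjTranspose, ← reducedRA_eq_amplitude_mul, reducedRA_eq hψ hD]
    simp only [hG, hH]
  obtain ⟨W, hW, hΨW⟩ := exists_isometry_of_mul_conjTranspose_eq hC hΨ
  -- B is the column index of `amplitude ψ`, so the embedding of the purifying system is the
  -- entrywise conjugate of `W`.
  have hV : (Wᴴᵀ)ᴴ * Wᴴᵀ = 1 := by
    have : (Wᴴᵀ)ᴴ * Wᴴᵀ = (Wᴴ * W)ᵀ := by
      ext i j
      simp [Matrix.mul_apply, mul_comm]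
    rw [this, hW, Matrix.transpose_one]
  set p : Fin D.J → ℝ := fun j => ∑ x, ∑ y, ‖H j x y‖ ^ 2 with hp
  have htr : ∀ j, (blockState ψ D j).trace = (p j : ℂ) := fun j => by
    rw [← hH, trace_mul_conjTranspose_eq_sum]
  have hp0 : ∀ j, 0 ≤ p j := fun j => by positivity
  -- The weight p_j = ‖H_j‖² is positive, so H_j/√p_j is a unit vector; a zero weight would mean a
  -- zero block state.
  have hpne : ∀ j, p j ≠ 0 := fun j h => by
    refine blockState_ne_zero hψ hD j ?_
    refine (Matrix.posSemidef_self_mul_conjTranspose _).trace_eq_zero_iff.1 ((htr j).trans ?_)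
    rw [h, Complex.ofReal_zero]
  have hsqrt : ∀ j, ((Real.sqrt (p j) : ℝ) : ℂ) ≠ 0 := fun j => by
    exact_mod_cast (Real.sqrt_pos.2 (lt_of_le_of_ne (hp0 j) (hpne j).symm)).ne'
  obtain ⟨P', hP'⟩ := exists_gram_mul_eq_one hC
  refine ⟨⟨dLB, dRB, Wᴴᵀ, hV, ?_, p, hp0, ?_, G, ?_,
    fun j x => ((Real.sqrt (p j) : ℝ) : ℂ)⁻¹ * H j (x.1, x.2.1) x.2.2, ?_, ?_⟩⟩
  · have h1 : reducedB ψ = Wᴴᵀ * ((blockPurification D G H)ᴴ * blockPurification D G H)ᵀ *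
        (Wᴴᵀ)ᴴ := by
      rw [reducedB_eq_amplitude_mul, hΨW, Matrix.transpose_mul, Matrix.transpose_mul,
        Matrix.conjTranspose_mul]
      simp only [Matrix.mul_assoc]
      rfl
    rw [h1]
    refine (range_mulVecLin_isometry_conj hV (P' := P'ᵀ) ?_).symm
    rw [← Matrix.transpose_mul, mul_eq_one_comm.1 hP', Matrix.transpose_one]
  · have h := sum_trace_blockState hψ hD
    simp only [htr] at h
    exact_mod_cast h
  · intro j
    have h := trace_mul_conjTranspose_eq_sum (G j)
    rw [hG, (hD.state j).2] at h
    exact_mod_cast h.symm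
  · intro j
    simp only [norm_mul, norm_inv, mul_pow, inv_pow, Complex.norm_real, Real.norm_eq_abs, sq_abs,
      Real.sq_sqrt (hp0 j), ← Finset.mul_sum]
    have : ∑ x : R × Fin (D.dR j) × Fin (dRB j), ‖H j (x.1, x.2.1) x.2.2‖ ^ 2 = p j := by
      simp only [hp, Fintype.sum_prod_type]
    rw [this, inv_mul_cancel₀ (hpne j)]
  · intro r a b
    have h : ψ (r, a, b) = amplitude ψ (r, a) b := rfl
    rw [h, hΨW, blockPurification_mul_apply]
    refine Finset.sum_congr rfl fun j _ => ?_
    simp only [Finset.mul_sum]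
    refine Finset.sum_congr rfl fun l _ => Finset.sum_congr rfl fun m _ =>
      Finset.sum_congr rfl fun l' _ => Finset.sum_congr rfl fun m' _ => ?_
    rw [Matrix.transpose_apply]
    field_simp [hsqrt j]

omit [DecidableEq A] in
/-- The block form of the operator `ψ^{RA}` along a tripartite decomposition. -/
theorem TripartiteForm.block_reducedRA_eq (T : TripartiteForm ψ D) (r r' : R) :
    ∃ X : ∀ j, Matrix (Fin (D.dR j)) (Fin (D.dR j)) ℂ,
      block (reducedRA ψ) r r' = blockEmbed D (fun j => T.ω j * (T.ω j)ᴴ) X := by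
  let H : ∀ j, Matrix (R × Fin (D.dR j)) (Fin (T.dRB j)) ℂ := fun j =>
    Matrix.of fun x y => ((Real.sqrt (T.p j) : ℝ) : ℂ) * T.φ j (x.1, x.2, y)
  have h : amplitude ψ = blockPurification D T.ω H * T.Vᵀ := by
    ext ⟨r, a⟩ b
    rw [blockPurification_mul_apply]
    refine (T.decomp r a b).trans (Finset.sum_congr rfl fun j _ => ?_)
    simp only [Finset.mul_sum, H, Matrix.of_apply]
    refine Finset.sum_congr rfl fun l _ => Finset.sum_congr rfl fun m _ =>
      Finset.sum_congr rfl fun l' _ => Finset.sum_congr rfl fun m' _ => ?_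
    rw [Matrix.transpose_apply]
    ring
  -- The isometry on B disappears from the marginal on R ⊗ A.
  have hV : T.Vᵀ * (T.Vᵀ)ᴴ = 1 := by
    have : T.Vᵀ * (T.Vᵀ)ᴴ = (T.Vᴴ * T.V)ᵀ := by
      rw [Matrix.transpose_mul]; rfl
    rw [this, T.isometry, Matrix.transpose_one]
  refine ⟨fun j => block (H j * (H j)ᴴ) r r', ?_⟩
  rw [reducedRA_eq_amplitude_mul, h, Matrix.conjTranspose_mul, Matrix.mul_assoc,
    ← Matrix.mul_assoc T.Vᵀ, hV, Matrix.one_mul, blockPurification_mul_conjTranspose,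
    block_one_kronecker_conj, block_blockDiagonal'_regroup]
  rfl

end TripartiteDecomposition

/-! ### Sampling with prescribed marginals -/

section Sampling

/-- A probability distribution `τ` on `N` with `τ i * |C| ≤ 1` is the distribution of each of the
values of a random injective function from `C` to `N`. -/
theorem exists_injective_sampling {N C : Type} [Fintype N] [DecidableEq N] [Fintype C]
    {τ : N → ℝ} (h0 : ∀ i, 0 ≤ τ i) (h1 : ∑ i, τ i = 1) (hτ : ∀ i, Fintype.card C * τ i ≤ 1) :
    ∃ (w : Equiv.Perm N → ℝ) (g : Equiv.Perm N → C → N), (∀ σ, 0 ≤ w σ) ∧ ∑ σ, w σ = 1 ∧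
      (∀ σ, Function.Injective (g σ)) ∧
      ∀ c i, ∑ σ, w σ * (if g σ c = i then 1 else 0) = τ i := by
  have hcard : Fintype.card C ≤ Fintype.card N := by
    have : (Fintype.card C : ℝ) ≤ Fintype.card N := by
      calc (Fintype.card C : ℝ) = ∑ i, Fintype.card C * τ i := by
            rw [← Finset.mul_sum, h1, mul_one]
        _ ≤ ∑ _i : N, (1 : ℝ) := Finset.sum_le_sum fun i _ => hτ i
        _ = Fintype.card N := by simp
    exact_mod_cast this
  obtain ⟨e, he⟩ := Nat.exists_eq_add_of_le hcard
  have φ : C ⊕ Fin e ≃ N := Fintype.equivOfCardEq (by simp [he])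
  have hsum : ∑ i, (1 - Fintype.card C * τ i) = e := by
    rw [Finset.sum_sub_distrib, ← Finset.mul_sum, h1]
    simp [he]
  -- The first |C| rows are copies of τ; the other e = |N| − |C| rows share the column deficits 1 −
  -- |C| τ_i equally. Nonnegativity of the deficits is the hypothesis `hτ`.
  let P : Matrix N N ℝ := fun n i =>
    Sum.elim (fun _ => τ i) (fun _ => (1 - Fintype.card C * τ i) / e) (φ.symm n)
  have hP : P ∈ doublyStochastic ℝ N := by
    rw [mem_doublyStochastic_iff_sum]
    refine ⟨fun n i => ?_, fun n => ?_, fun i => ?_⟩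
    · simp only [P]
      rcases φ.symm n with c | k
      · exact h0 i
      · exact div_nonneg (sub_nonneg.2 (hτ i)) (Nat.cast_nonneg e)
    · simp only [P]
      rcases φ.symm n with c | k
      · exact h1
      · have : (e : ℝ) ≠ 0 := by exact_mod_cast (Fin.pos k).ne'
        simp only [Sum.elim_inr]
        rw [← Finset.sum_div, hsum, div_self this]
    · rw [← Equiv.sum_comp φ]
      simp only [P, Equiv.symm_apply_apply, Fintype.sum_sum_type, Sum.elim_inl, Sum.elim_inr,
        Finset.sum_const, Finset.card_univ, nsmul_eq_mul, Fintype.card_fin]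
      -- Without filler rows the nonnegative deficits sum to zero, so each vanishes and the columns
      -- are already complete.
      rcases Nat.eq_zero_or_pos e with rfl | hpos
      · have := (Finset.sum_eq_zero_iff_of_nonneg fun i _ => sub_nonneg.2 (hτ i)).1
          (hsum.trans Nat.cast_zero) i (Finset.mem_univ i)
        simp only [CharP.cast_eq_zero, zero_mul, add_zero]
        linarith
      · have : (e : ℝ) ≠ 0 := by exact_mod_cast hpos.ne'
        rw [mul_div_cancel₀ _ this]
        ring
  -- Birkhoff: `P` is an average of permutations, and restricting each to the first |C| rows gives
  -- injections with marginal τ.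
  obtain ⟨w, hw0, hw1, hwP⟩ := exists_eq_sum_perm_of_mem_doublyStochastic hP
  refine ⟨w, fun σ c => σ (φ (Sum.inl c)), hw0, hw1,
    fun σ => σ.injective.comp (φ.injective.comp Sum.inl_injective), fun c i => ?_⟩
  have h := congrFun (congrFun hwP (φ (Sum.inl c))) i
  simp only [P, Equiv.symm_apply_apply, Sum.elim_inl, Matrix.sum_apply, Matrix.smul_apply,
    smul_eq_mul] at h
  rw [← h]
  refine Finset.sum_congr rfl fun σ _ => ?_
  simp [Equiv.Perm.permMatrix, PEquiv.toMatrix_apply, Equiv.toPEquiv_apply, eq_comm]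

/-- The sum of a product of functions of independent variables. -/
theorem sum_prod_mul_apply {J : Type} [Fintype J] [DecidableEq J] {Ω : J → Type}
    [∀ j, Fintype (Ω j)] {w : ∀ j, Ω j → ℝ} (hw : ∀ j, ∑ m, w j m = 1) (j : J)
    (h : Ω j → ℝ) : ∑ ω : ∀ j, Ω j, (∏ i, w i (ω i)) * h (ω j) = ∑ m, w j m * h m := by
  classical
  -- Absorbing `h` into factor j leaves a pure product, whose sum factorizes.
  let f : ∀ i, Ω i → ℝ := Function.update w j fun m => w j m * h m
  have h1 : ∀ ω : ∀ j, Ω j, (∏ i, w i (ω i)) * h (ω j) = ∏ i, f i (ω i) := fun ω => by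
    rw [← Finset.mul_prod_erase Finset.univ (fun i => w i (ω i)) (Finset.mem_univ j),
      ← Finset.mul_prod_erase Finset.univ (fun i => f i (ω i)) (Finset.mem_univ j)]
    have : ∏ i ∈ Finset.univ.erase j, f i (ω i) = ∏ i ∈ Finset.univ.erase j, w i (ω i) :=
      Finset.prod_congr rfl fun i hi => by
        simp only [f, Function.update_of_ne (Finset.ne_of_mem_erase hi)]
    rw [this]
    simp only [f, Function.update_self]
    ring
  have h2 : ∑ ω : ∀ j, Ω j, ∏ i, f i (ω i) = ∏ i, ∑ m, f i m := by
    rw [Finset.prod_univ_sum, Fintype.piFinset_univ]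
  simp only [h1, h2]
  rw [← Finset.mul_prod_erase Finset.univ _ (Finset.mem_univ j), Finset.prod_eq_one, mul_one]
  · simp only [f, Function.update_self]
  · intro i hi
    simp only [f, Function.update_of_ne (Finset.ne_of_mem_erase hi), hw]

/-- A joint version of `exists_injective_sampling` for a family of distributions. -/
theorem exists_joint_injective_sampling {J : Type} [Fintype J] [DecidableEq J] {N C : J → Type}
    [∀ j, Fintype (N j)] [∀ j, DecidableEq (N j)] [∀ j, Fintype (C j)]
    {τ : ∀ j, N j → ℝ} (h0 : ∀ j i, 0 ≤ τ j i) (h1 : ∀ j, ∑ i, τ j i = 1)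
    (hτ : ∀ j i, Fintype.card (C j) * τ j i ≤ 1) :
    ∃ (w : (∀ j, Equiv.Perm (N j)) → ℝ) (g : (∀ j, Equiv.Perm (N j)) → ∀ j, C j → N j),
      (∀ σ, 0 ≤ w σ) ∧ ∑ σ, w σ = 1 ∧ (∀ σ j, Function.Injective (g σ j)) ∧
      ∀ j c i, ∑ σ, w σ * (if g σ j c = i then 1 else 0) = τ j i := by
  choose w g hw0 hw1 hg hwg using fun j => exists_injective_sampling (h0 j) (h1 j) (hτ j)
  refine ⟨fun σ => ∏ j, w j (σ j), fun σ j => g j (σ j),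
    fun σ => Finset.prod_nonneg fun j _ => hw0 j _, ?_, fun σ j => hg j _, fun j c i => ?_⟩
  · rw [← Fintype.piFinset_univ, ← Finset.prod_univ_sum]
    exact Finset.prod_eq_one fun j _ => hw1 j
  · rw [sum_prod_mul_apply hw1 j fun m => if g j m c = i then 1 else 0]
    exact hwg j c i

/-- Independent uniformly random signs are uncorrelated. -/
theorem sum_sign_mul_sign {Y : Type} [Fintype Y] [DecidableEq Y] (y y' : Y) :
    ∑ s : Y → ℤˣ, (((s y : ℤ) : ℝ) * ((s y' : ℤ) : ℝ)) =
      if y = y' then 2 ^ Fintype.card Y else 0 := by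
  split_ifs with h
  · subst h
    have : ∀ s : Y → ℤˣ, (((s y : ℤ) : ℝ) * ((s y : ℤ) : ℝ)) = 1 := fun s => by
      rcases Int.units_eq_one_or (s y) with h | h <;> simp [h]
    simp [this]
  · have h1 := Equiv.sum_comp (Equiv.mulLeft (Function.update (1 : Y → ℤˣ) y (-1)))
      fun s : Y → ℤˣ => (((s y : ℤ) : ℝ) * ((s y' : ℤ) : ℝ))
    simp only [Equiv.coe_mulLeft, Pi.mul_apply, Function.update_self,
      Function.update_of_ne (Ne.symm h), Pi.one_apply, one_mul, Units.val_neg, Int.cast_neg, neg_mul,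
      Finset.sum_neg_distrib] at h1
    linarith

end Sampling

/-! ### The measurement of the party `A` -/

section Measurement

variable {J : ℕ} {dL dR : Fin J → ℕ} {K L : ℕ}

/-- The real coefficients of the measurement operators: the measurement randomly and injectively
assigns to each pair of a basis vector of `a_j^R` and an output a basis vector of
`a_j^L ⊗ ℂ^K`, and attaches signs to the basis vectors of all the spaces `a_j^R`. -/
def decouplingCoeff (t : ∀ j, Fin (dL j) → ℝ) (w : ℝ)
    (g : ∀ j, Fin (dR j) × Fin L → Fin (dL j) × Fin K) (l : Fin L)
    (x : (Σ j, Fin (dL j) × Fin (dR j)) × Fin K) : ℝ :=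
  if g x.1.1 (x.1.2.2, l) = (x.1.2.1, x.2) then
    Real.sqrt (w / 2 ^ Fintype.card (Σ j, Fin (dR j))) / Real.sqrt (L * (t x.1.1 x.1.2.1 / K))
  else 0

/-- The measurement operators of the party `A`. -/
def decouplingKraus (t : ∀ j, Fin (dL j) → ℝ) (w : ℝ)
    (g : ∀ j, Fin (dR j) × Fin L → Fin (dL j) × Fin K) (s : (Σ j, Fin (dR j)) → ℤˣ) :
    Matrix (Fin L) ((Σ j, Fin (dL j) × Fin (dR j)) × Fin K) ℂ :=
  fun l x => ((decouplingCoeff t w g l x * ((s ⟨x.1.1, x.1.2.2⟩ : ℤ) : ℝ) : ℝ) : ℂ)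

/-- The signs kill entries between different (j, b). On the diagonal each of the L outputs hits (a,
k) with probability t/K, cancelling the normalization L · t/K; eigenvectors with t = 0 are never
hit. -/
theorem sum_decouplingKraus {Ω : Type} [Fintype Ω] {t : ∀ j, Fin (dL j) → ℝ} {w : Ω → ℝ}
    {g : Ω → ∀ j, Fin (dR j) × Fin L → Fin (dL j) × Fin K} (hK : 0 < K) (hL : 0 < L)
    (ht : ∀ j x, 0 ≤ t j x) (hw : ∀ m, 0 ≤ w m)
    (hwg : ∀ j c i, ∑ m, w m * (if g m j c = i then 1 else 0) = t j i.1 / K) :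
    ∑ m : Ω × ((Σ j, Fin (dR j)) → ℤˣ),
      (decouplingKraus t (w m.1) (g m.1) m.2)ᴴ * decouplingKraus t (w m.1) (g m.1) m.2 =
      Matrix.diagonal fun x => if t x.1.1 x.1.2.1 = 0 then 0 else 1 := by
  have hK' : (0 : ℝ) < K := by exact_mod_cast hK
  have hL' : (0 : ℝ) < L := by exact_mod_cast hL
  ext x x'
  have h1 : (∑ m : Ω × ((Σ j, Fin (dR j)) → ℤˣ),
      (decouplingKraus t (w m.1) (g m.1) m.2)ᴴ * decouplingKraus t (w m.1) (g m.1) m.2) x x' =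
      ((∑ m, ∑ l, decouplingCoeff t (w m) (g m) l x * decouplingCoeff t (w m) (g m) l x' *
        (if (⟨x.1.1, x.1.2.2⟩ : Σ j, Fin (dR j)) = ⟨x'.1.1, x'.1.2.2⟩ then
          2 ^ Fintype.card (Σ j, Fin (dR j)) else 0) : ℝ) : ℂ) := by
    simp only [Matrix.sum_apply, Fintype.sum_prod_type, Matrix.mul_apply,
      Matrix.conjTranspose_apply, decouplingKraus, Complex.star_def, Complex.conj_ofReal,
      ← Complex.ofReal_mul, ← Complex.ofReal_sum]
    congr 1
    refine Finset.sum_congr rfl fun m _ => ?_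
    rw [Finset.sum_comm]
    refine Finset.sum_congr rfl fun l _ => ?_
    rw [← sum_sign_mul_sign, Finset.mul_sum]
    refine Finset.sum_congr rfl fun s _ => ?_
    ring
  rw [h1]
  rcases eq_or_ne x x' with rfl | hx
  · obtain ⟨⟨j, a, b⟩, k⟩ := x
    simp only [if_true, Matrix.diagonal_apply_eq]
    have h2 : ∀ m l, decouplingCoeff t (w m) (g m) l (⟨j, a, b⟩, k) *
        decouplingCoeff t (w m) (g m) l (⟨j, a, b⟩, k) *
        2 ^ Fintype.card (Σ j, Fin (dR j)) =
        w m * (if g m j (b, l) = (a, k) then 1 else 0) / (L * (t j a / K)) := fun m l => by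
      have hpow : (0 : ℝ) < 2 ^ Fintype.card (Σ j, Fin (dR j)) := by positivity
      simp only [decouplingCoeff]
      split_ifs
      · rw [div_mul_div_comm, Real.mul_self_sqrt (div_nonneg (hw m) hpow.le),
          Real.mul_self_sqrt (mul_nonneg hL'.le (div_nonneg (ht j a) hK'.le))]
        rw [div_mul_eq_mul_div, div_mul_cancel₀ _ hpow.ne', mul_one]
      · simp
    simp only [h2]
    rw [Finset.sum_comm]
    simp only [← Finset.sum_div, hwg]
    by_cases h : t j a = 0
    · simp [h]
    · have : (L : ℝ) * (t j a / K) ≠ 0 := mul_ne_zero hL'.ne' (div_ne_zero h hK'.ne')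
      rw [Finset.sum_const, Finset.card_univ, Fintype.card_fin, nsmul_eq_mul, ← mul_div_assoc,
        div_self (by rwa [mul_div_assoc]), if_neg h, Complex.ofReal_one]
  · rw [Matrix.diagonal_apply_ne _ hx]
    rw [Finset.sum_eq_zero, Complex.ofReal_zero]
    intro m _
    refine Finset.sum_eq_zero fun l _ => ?_
    obtain ⟨⟨j, a, b⟩, k⟩ := x
    obtain ⟨⟨j', a', b'⟩, k'⟩ := x'
    simp only
    -- For equal (j, b) the remaining indices (a, k) differ, and one value of the injection cannot
    -- equal both.
    split_ifs with h
    · obtain ⟨rfl, h⟩ := Sigma.mk.inj_iff.1 h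
      obtain rfl := eq_of_heq h
      by_cases h3 : g m j (b, l) = (a, k)
      · have h4 : g m j (b, l) ≠ (a', k') := by
          rw [h3]
          rintro h5
          obtain ⟨rfl, rfl⟩ := Prod.ext_iff.1 h5
          exact hx rfl
        simp [decouplingCoeff, h4]
      · simp [decouplingCoeff, h3]
    · rw [mul_zero]

/-- A basis vector (a, k) contributes only if it is the image of both (y, l) and (y', l'), so
injectivity forces y = y' and l = l'. The factor t of ω_j cancels against the squared rescaling,
leaving the same weight for every j and y, hence a multiple of the identity. -/
theorem decouplingKraus_conj {t : ∀ j, Fin (dL j) → ℝ} {w : ℝ}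
    {g : ∀ j, Fin (dR j) × Fin L → Fin (dL j) × Fin K} (hK : 0 < K) (hL : 0 < L)
    (ht : ∀ j x, 0 ≤ t j x) (hw : 0 ≤ w) (hg : ∀ j, Function.Injective (g j))
    (hwg : ∀ j c, w ≤ t j (g j c).1 / K) (s : (Σ j, Fin (dR j)) → ℤˣ)
    (X : ∀ j, Matrix (Fin (dR j)) (Fin (dR j)) ℂ) :
    decouplingKraus t w g s *
      ((Matrix.blockDiagonal' fun j => Matrix.diagonal (fun x => (t j x : ℂ)) ⊗ₖ X j) ⊗ₖ
        (1 : Matrix (Fin K) (Fin K) ℂ)) * (decouplingKraus t w g s)ᴴ =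
      (((w / 2 ^ Fintype.card (Σ j, Fin (dR j)) : ℝ) : ℂ) * (K / L) * ∑ j, (X j).trace) •
        (1 : Matrix (Fin L) (Fin L) ℂ) := by
  have hK' : (0 : ℝ) < K := by exact_mod_cast hK
  have hL' : (0 : ℝ) < L := by exact_mod_cast hL
  ext l l'
  have h1 : (decouplingKraus t w g s *
      ((Matrix.blockDiagonal' fun j => Matrix.diagonal (fun x => (t j x : ℂ)) ⊗ₖ X j) ⊗ₖ
        (1 : Matrix (Fin K) (Fin K) ℂ)) * (decouplingKraus t w g s)ᴴ) l l' =
      ∑ j, ∑ y, ∑ y', X j y y' * ((∑ p : Fin (dL j) × Fin K, t j p.1 *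
        (decouplingCoeff t w g l (⟨j, p.1, y⟩, p.2) * ((s ⟨j, y⟩ : ℤ) : ℝ)) *
        (decouplingCoeff t w g l' (⟨j, p.1, y'⟩, p.2) * ((s ⟨j, y'⟩ : ℤ) : ℝ)) : ℝ) : ℂ) := by
    have hcol : ∀ j x y' k, (decouplingKraus t w g s *
        ((Matrix.blockDiagonal' fun j => Matrix.diagonal (fun x => (t j x : ℂ)) ⊗ₖ X j) ⊗ₖ
          (1 : Matrix (Fin K) (Fin K) ℂ))) l (⟨j, (x, y')⟩, k) =
        ∑ y, decouplingKraus t w g s l (⟨j, (x, y)⟩, k) * (t j x * X j y y') :=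
      fun j x y' k => by
        simp only [Matrix.mul_apply, Fintype.sum_prod_type, Fintype.sum_sigma,
          Matrix.kroneckerMap_apply, Matrix.one_apply]
        rw [Finset.sum_eq_single j (fun j' _ hj => by
            simp [Matrix.blockDiagonal'_apply, hj]) (by simp),
          Finset.sum_eq_single x (fun x' _ hx => by
            simp [Matrix.blockDiagonal'_apply, hx]) (by simp)]
        refine Finset.sum_congr rfl fun y _ => ?_
        rw [Finset.sum_eq_single k (fun k' _ hk => by simp [hk]) (by simp)]
        simp [Matrix.blockDiagonal'_apply]
    rw [Matrix.mul_apply]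
    simp only [Fintype.sum_prod_type, Fintype.sum_sigma, hcol, Matrix.conjTranspose_apply,
      Finset.sum_mul, Finset.mul_sum, Complex.ofReal_sum]
    refine Finset.sum_congr rfl fun j _ => ?_
    calc _ = ∑ x, ∑ y', ∑ y, ∑ k, _ :=
          Finset.sum_congr rfl fun x _ => Finset.sum_congr rfl fun y' _ => Finset.sum_comm
      _ = ∑ x, ∑ y, ∑ y', ∑ k, _ := Finset.sum_congr rfl fun x _ => Finset.sum_comm
      _ = ∑ y, ∑ x, ∑ y', ∑ k, _ := Finset.sum_comm
      _ = ∑ y, ∑ y', ∑ x, ∑ k, _ := Finset.sum_congr rfl fun y _ => Finset.sum_comm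
    refine Finset.sum_congr rfl fun y _ => Finset.sum_congr rfl fun y' _ =>
      Finset.sum_congr rfl fun x _ => Finset.sum_congr rfl fun k _ => ?_
    simp only [decouplingKraus, Complex.star_def, Complex.conj_ofReal]
    simp only [Complex.ofReal_mul]
    ring
  have h2 : ∀ j y y', (∑ p : Fin (dL j) × Fin K, t j p.1 *
      (decouplingCoeff t w g l (⟨j, p.1, y⟩, p.2) * ((s ⟨j, y⟩ : ℤ) : ℝ)) *
      (decouplingCoeff t w g l' (⟨j, p.1, y'⟩, p.2) * ((s ⟨j, y'⟩ : ℤ) : ℝ))) =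
      if y = y' ∧ l = l' then w / 2 ^ Fintype.card (Σ j, Fin (dR j)) * (K / L) else 0 := by
    intro j y y'
    have hpow : (0 : ℝ) < 2 ^ Fintype.card (Σ j, Fin (dR j)) := by positivity
    rw [Finset.sum_eq_single (g j (y, l))]
    · split_ifs with h
      · obtain ⟨rfl, rfl⟩ := h
        simp only [decouplingCoeff, if_true]
        have hs : (((s ⟨j, y⟩ : ℤ) : ℝ) * ((s ⟨j, y⟩ : ℤ) : ℝ)) = 1 := by
          rcases Int.units_eq_one_or (s ⟨j, y⟩) with h | h <;> simp [h]
        set T := t j (g j (y, l)).1 with hT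
        have hT0 : 0 ≤ T := ht _ _
        have hsq : ∀ a b c d : ℝ, T * (a / b * c) * (a / b * c) = T * (a * a / (b * b)) * (c * c) :=
          fun a b c d => by ring
        rw [hsq _ _ _ 0, hs, Real.mul_self_sqrt (div_nonneg hw hpow.le),
          Real.mul_self_sqrt (mul_nonneg hL'.le (div_nonneg hT0 hK'.le)), mul_one]
        -- At a zero eigenvalue the rescaling is the default 0; the identity survives because `hwg`
        -- then forces w = 0.
        rcases eq_or_lt_of_le hT0 with h0 | h0
        · have : w = 0 := le_antisymm ((hwg j (y, l)).trans (by rw [← hT, ← h0]; simp)) hw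
          simp [this]
        · field_simp
      · have h3 : g j (y', l') ≠ g j (y, l) := fun h' => h (by
          obtain ⟨h5, h6⟩ := Prod.ext_iff.1 (hg j h')
          exact ⟨h5.symm, h6.symm⟩)
        simp [decouplingCoeff, h3]
    · intro p _ hp
      simp [decouplingCoeff, Ne.symm hp]
    · simp
  rw [h1]
  simp only [h2, Matrix.smul_apply, Matrix.one_apply, smul_eq_mul, Matrix.trace, Matrix.diag,
    Finset.mul_sum, Finset.sum_mul]
  refine Finset.sum_congr rfl fun j _ => Finset.sum_congr rfl fun y _ => ?_
  rw [Finset.sum_eq_single y (fun y' _ hy => by simp [Ne.symm hy]) (by simp)]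
  by_cases h : l = l'
  · simp [h]
    ring
  · simp [h]

end Measurement

/-! ### Completion of the Kraus operators to a decoupling measurement on all of A ⊗ ℂ^K. -/

section DecouplingMeasurement

variable {A : Type} [Fintype A] [DecidableEq A]

/-- There is a measurement on `A ⊗ ℂ^K` with outputs in `ℂ^L` all of whose outcomes decouple every
operator of the form `⨁ j, ω_j ⊗ X_j`, where the eigenvalues `t j` of the states `ω_j` satisfy
`t j x * (dR j * L) ≤ K`. -/
theorem exists_decoupling_measurement {J : ℕ} {dL dR : Fin J → ℕ} {K L : ℕ} (hL : 0 < L)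
    {U : Matrix A (Σ j, Fin (dL j) × Fin (dR j)) ℂ} (hU : Uᴴ * U = 1)
    {t : ∀ j, Fin (dL j) → ℝ} (ht : ∀ j x, 0 ≤ t j x) (ht1 : ∀ j, ∑ x, t j x = 1)
    (htK : ∀ j x, t j x * (dR j * L) ≤ K) (hK : 0 < K) :
    ∃ (ι : Type) (_ : Fintype ι) (M : ι → Matrix (Fin L) (A × Fin K) ℂ) (q : ι → ℝ),
      ∑ m, (M m)ᴴ * M m = 1 ∧ (∀ m, 0 ≤ q m) ∧ ∑ m, q m = 1 ∧
      ∀ (m : ι) (X : ∀ j, Matrix (Fin (dR j)) (Fin (dR j)) ℂ) (ρ : Matrix A A ℂ),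
        ρ = U * (Matrix.blockDiagonal' fun j =>
          Matrix.diagonal (fun x => (t j x : ℂ)) ⊗ₖ X j) * Uᴴ →
        M m * (ρ ⊗ₖ (1 : Matrix (Fin K) (Fin K) ℂ)) * (M m)ᴴ =
          ((q m : ℂ) * (K / L) * ρ.trace) • (1 : Matrix (Fin L) (Fin L) ℂ) := by
  have hK' : (0 : ℝ) < K := by exact_mod_cast hK
  obtain ⟨w, g, hw0, hw1, hg, hwg⟩ := exists_joint_injective_sampling
    (N := fun j => Fin (dL j) × Fin K) (C := fun j => Fin (dR j) × Fin L)
    (τ := fun j i => t j i.1 / K) (fun j i => div_nonneg (ht j i.1) hK'.le)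
    (fun j => by
      simp only [Fintype.sum_prod_type, Finset.sum_const, Finset.card_univ, Fintype.card_fin,
        nsmul_eq_mul, mul_div_cancel₀ _ hK'.ne', ht1])
    (fun j i => by
      simp only [Fintype.card_prod, Fintype.card_fin, Nat.cast_mul]
      rw [← mul_div_assoc, div_le_one hK', mul_comm]
      exact htK j i.1)
  -- A single weight is at most the marginal probability of the value that it produces.
  have hle : ∀ m j c, w m ≤ t j (g m j c).1 / K := fun m j c => by
    rw [← hwg j c (g m j c)]
    refine le_trans (by simp) (Finset.single_le_sum (f := fun σ =>
      w σ * (if g σ j c = g m j c then 1 else 0)) (fun σ _ => ?_) (Finset.mem_univ m))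
    exact mul_nonneg (hw0 σ) (by split_ifs <;> norm_num)
  set V : Matrix (A × Fin K) ((Σ j, Fin (dL j) × Fin (dR j)) × Fin K) ℂ :=
    U ⊗ₖ (1 : Matrix (Fin K) (Fin K) ℂ) with hV
  have hVV : Vᴴ * V = 1 := by
    rw [hV, Matrix.conjTranspose_kronecker, ← Matrix.mul_kronecker_mul, hU,
      Matrix.conjTranspose_one, Matrix.one_mul, Matrix.one_kronecker_one]
  -- The Kraus operators are complete only on the span of eigenvectors with t ≠ 0. The complement is
  -- filled with outcomes of weight 0, which annihilate all operators ρ ⊗ 1 of the required form.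
  set E : Matrix ((Σ j, Fin (dL j) × Fin (dR j)) × Fin K)
    ((Σ j, Fin (dL j) × Fin (dR j)) × Fin K) ℂ :=
    Matrix.diagonal fun x => if t x.1.1 x.1.2.1 = 0 then 0 else 1 with hE
  have hEE : E * E = E := by
    rw [hE, Matrix.diagonal_mul_diagonal]
    congr 1
    funext x
    split_ifs <;> simp
  have hEH : Eᴴ = E := by
    rw [hE, Matrix.diagonal_conjTranspose]
    congr 1
    funext x
    simp only [Pi.star_apply]
    split_ifs <;> simp
  have hP : (V * E * Vᴴ)ᴴ = V * E * Vᴴ := by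
    simp only [Matrix.conjTranspose_mul, Matrix.conjTranspose_conjTranspose, hEH, Matrix.mul_assoc]
  have hPV : ∀ S : Matrix _ _ ℂ, E * S = S → V * E * Vᴴ * (V * S) = V * S := fun S hS => by
    rw [Matrix.mul_assoc, ← Matrix.mul_assoc Vᴴ, hVV, Matrix.one_mul, Matrix.mul_assoc, hS]
  have hPP : V * E * Vᴴ * (V * E * Vᴴ) = V * E * Vᴴ := by
    rw [← Matrix.mul_assoc, hPV E hEE]
  let M₀ := fun m : (∀ j, Equiv.Perm (Fin (dL j) × Fin K)) × ((Σ j, Fin (dR j)) → ℤˣ) =>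
    decouplingKraus t (w m.1) (g m.1) m.2
  have hM₀ : ∑ m, (M₀ m)ᴴ * M₀ m = E := sum_decouplingKraus hK hL ht hw0 hwg
  refine ⟨((∀ j, Equiv.Perm (Fin (dL j) × Fin K)) × ((Σ j, Fin (dR j)) → ℤˣ)) ⊕ (A × Fin K),
    inferInstance, Sum.elim (fun m => M₀ m * Vᴴ)
      (fun x => Matrix.single ⟨0, hL⟩ x (1 : ℂ) * (1 - V * E * Vᴴ)),
    Sum.elim (fun m => w m.1 / 2 ^ Fintype.card (Σ j, Fin (dR j))) (fun _ => 0), ?_, ?_, ?_, ?_⟩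
  · simp only [Fintype.sum_sum_type, Sum.elim_inl, Sum.elim_inr]
    rw [sum_single_mul_compl_projection hP hPP]
    have : ∀ m, (M₀ m * Vᴴ)ᴴ * (M₀ m * Vᴴ) = V * ((M₀ m)ᴴ * M₀ m) * Vᴴ := fun m => by
      simp only [Matrix.conjTranspose_mul, Matrix.conjTranspose_conjTranspose, Matrix.mul_assoc]
    simp only [this]
    rw [← Matrix.sum_mul, ← Matrix.mul_sum, hM₀, add_sub_cancel]
  · rintro (m | x)
    · exact div_nonneg (hw0 _) (by positivity)
    · exact le_rfl
  · simp only [Fintype.sum_sum_type, Sum.elim_inl, Sum.elim_inr, Finset.sum_const_zero, add_zero,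
      Fintype.sum_prod_type, Finset.sum_const, nsmul_eq_mul, ← Finset.sum_div, ← Finset.mul_sum]
    rw [hw1]
    simp
  · intro m X ρ hρ
    set S := (Matrix.blockDiagonal' fun j => Matrix.diagonal (fun x => (t j x : ℂ)) ⊗ₖ X j) ⊗ₖ
      (1 : Matrix (Fin K) (Fin K) ℂ) with hS
    have hρS : ρ ⊗ₖ (1 : Matrix (Fin K) (Fin K) ℂ) = V * S * Vᴴ := by
      rw [hρ, hS, hV, Matrix.conjTranspose_kronecker, ← Matrix.mul_kronecker_mul,
        ← Matrix.mul_kronecker_mul, Matrix.conjTranspose_one, Matrix.one_mul, Matrix.one_mul]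
    have htr : ρ.trace = ∑ j, (X j).trace := by
      rw [hρ, Matrix.trace_mul_comm, ← Matrix.mul_assoc, hU, Matrix.one_mul,
        Matrix.trace_blockDiagonal']
      refine Finset.sum_congr rfl fun j _ => ?_
      rw [Matrix.trace_kronecker, Matrix.trace_diagonal, ← Complex.ofReal_sum, ht1,
        Complex.ofReal_one, one_mul]
    have hES : E * S = S := by
      ext ⟨⟨j, x, y⟩, k⟩ ⟨⟨j', x', y'⟩, k'⟩
      rw [hE, Matrix.diagonal_mul]
      simp only
      split_ifs with h
      · rw [zero_mul, hS, Matrix.kroneckerMap_apply]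
        by_cases hj : j = j'
        · subst hj
          by_cases hx : x = x'
          · subst hx
            simp [Matrix.blockDiagonal'_apply, h]
          · simp [Matrix.blockDiagonal'_apply, hx]
        · simp [Matrix.blockDiagonal'_apply, hj]
      · rw [one_mul]
    rcases m with m | x
    · simp only [Sum.elim_inl]
      rw [hρS, htr, ← decouplingKraus_conj hK hL ht (hw0 m.1) (hg m.1) (hle m.1) m.2 X]
      rw [Matrix.conjTranspose_mul, Matrix.conjTranspose_conjTranspose]
      have : M₀ m * Vᴴ * (V * S * Vᴴ) * (V * (M₀ m)ᴴ) =
          M₀ m * (Vᴴ * V) * S * (Vᴴ * V) * (M₀ m)ᴴ := by simp only [Matrix.mul_assoc]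
      rw [this, hVV, Matrix.mul_one, Matrix.mul_one]
    · simp only [Sum.elim_inr]
      rw [hρS, Matrix.mul_assoc (Matrix.single _ _ _), Matrix.sub_mul, Matrix.one_mul,
        ← Matrix.mul_assoc _ (V * S), hPV S hES, sub_self]
      simp

variable {R B : Type} [Fintype R] [DecidableEq R] [Fintype B] {ψ : R × A × B → ℂ}
  {D : BlockDecomposition A}

omit [DecidableEq R] [DecidableEq A] in
theorem TripartiteForm.J_pos (T : TripartiteForm ψ D) : 0 < D.J := by
  rcases Nat.eq_zero_or_pos D.J with h | h
  · have : IsEmpty (Fin D.J) := by rw [h]; infer_instance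
    have h1 := T.p_sum
    simp at h1
  · exact h

omit [DecidableEq R] [DecidableEq A] in
theorem TripartiteForm.eigenvalues_le_lambda0 (T : TripartiteForm ψ D) (j : Fin D.J)
    (i : Fin (D.dL j)) :
    (Matrix.isHermitian_mul_conjTranspose_self (T.ω j)).eigenvalues i ≤ T.lambda0 j :=
  le_ciSup (Set.finite_range _).bddAbove i

omit [DecidableEq R] [DecidableEq A] in
theorem TripartiteForm.sum_eigenvalues (T : TripartiteForm ψ D) (j : Fin D.J) :
    ∑ i, (Matrix.isHermitian_mul_conjTranspose_self (T.ω j)).eigenvalues i = 1 := by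
  have h := (Matrix.isHermitian_mul_conjTranspose_self (T.ω j)).trace_eq_sum_eigenvalues
  rw [trace_mul_conjTranspose_eq_sum, T.ω_unit j] at h
  exact Complex.ofReal_injective ((Complex.ofReal_sum _ _).trans h.symm)

omit [DecidableEq R] [DecidableEq A] in
theorem TripartiteForm.lambda0_pos (T : TripartiteForm ψ D) (j : Fin D.J) : 0 < T.lambda0 j := by
  by_contra h
  have h1 := Finset.sum_nonpos fun i (_ : i ∈ Finset.univ) =>
    (T.eigenvalues_le_lambda0 j i).trans (not_lt.1 h)
  rw [T.sum_eigenvalues j] at h1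
  exact absurd h1 (by norm_num)

theorem TripartiteForm.exists_decoupling_measurement (T : TripartiteForm ψ D) {K L : ℕ}
    (hK : 0 < K) (hL : 0 < L) (h : ∀ j, T.lambda0 j * D.dR j * L ≤ K) :
    ∃ (ι : Type) (_ : Fintype ι) (M : ι → Matrix (Fin L) (A × Fin K) ℂ) (q : ι → ℝ),
      ∑ m, (M m)ᴴ * M m = 1 ∧ (∀ m, 0 ≤ q m) ∧ ∑ m, q m = 1 ∧
      ∀ m r r', M m * (block (reducedRA ψ) r r' ⊗ₖ (1 : Matrix (Fin K) (Fin K) ℂ)) * (M m)ᴴ =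
          ((q m : ℂ) * (K / L) * (block (reducedRA ψ) r r').trace) •
            (1 : Matrix (Fin L) (Fin L) ℂ) := by
  have hH := fun j => Matrix.isHermitian_mul_conjTranspose_self (T.ω j)
  -- Eigenbases of the ω_j are absorbed into the embedding, reducing to diagonal ω_j; λ_0 enters
  -- only as the bound on their eigenvalues.
  let Q : ∀ j, Matrix (Fin (D.dL j)) (Fin (D.dL j)) ℂ := fun j => (hH j).eigenvectorUnitary
  have hQ : ∀ j, (Q j)ᴴ * Q j = 1 := fun j => Unitary.coe_star_mul_self (hH j).eigenvectorUnitary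
  set N : Matrix (Σ j, Fin (D.dL j) × Fin (D.dR j)) (Σ j, Fin (D.dL j) × Fin (D.dR j)) ℂ :=
    Matrix.blockDiagonal' fun j => Q j ⊗ₖ (1 : Matrix (Fin (D.dR j)) (Fin (D.dR j)) ℂ) with hN
  have hNH : Nᴴ = Matrix.blockDiagonal' fun j =>
      (Q j)ᴴ ⊗ₖ (1 : Matrix (Fin (D.dR j)) (Fin (D.dR j)) ℂ) := by
    rw [hN, Matrix.blockDiagonal'_conjTranspose]
    simp only [Matrix.conjTranspose_kronecker, Matrix.conjTranspose_one]
  have hNN : Nᴴ * N = 1 := by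
    rw [hNH, hN, ← Matrix.blockDiagonal'_mul]
    simp only [← Matrix.mul_kronecker_mul, hQ, Matrix.one_mul, Matrix.one_kronecker_one]
    exact Matrix.blockDiagonal'_one
  have hUN : (D.U * N)ᴴ * (D.U * N) = 1 := by
    rw [Matrix.conjTranspose_mul, Matrix.mul_assoc, ← Matrix.mul_assoc D.Uᴴ, D.isometry,
      Matrix.one_mul, hNN]
  obtain ⟨ι, hι, M, q, hM, hq0, hq1, hMq⟩ := StateMerging.exists_decoupling_measurement hL hUN (t := fun j => (hH j).eigenvalues)
    (fun j => (Matrix.posSemidef_self_mul_conjTranspose (T.ω j)).eigenvalues_nonneg)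
    T.sum_eigenvalues (fun j x => (mul_le_mul_of_nonneg_right (T.eigenvalues_le_lambda0 j x)
      (by positivity)).trans (by rw [← mul_assoc]; exact h j)) hK
  refine ⟨ι, hι, M, q, hM, hq0, hq1, fun m r r' => ?_⟩
  obtain ⟨X, hX⟩ := T.block_reducedRA_eq r r'
  refine hMq m X _ (hX.trans ?_)
  simp only [blockEmbed, LinearMap.coe_mk, AddHom.coe_mk]
  have h1 : (Matrix.blockDiagonal' fun j => (T.ω j * (T.ω j)ᴴ) ⊗ₖ X j) =
      N * (Matrix.blockDiagonal' fun j =>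
        Matrix.diagonal (fun x => ((hH j).eigenvalues x : ℂ)) ⊗ₖ X j) * Nᴴ := by
    rw [hNH, hN, ← Matrix.blockDiagonal'_mul, ← Matrix.blockDiagonal'_mul]
    congr 1
    funext j
    rw [← Matrix.mul_kronecker_mul, ← Matrix.mul_kronecker_mul, Matrix.one_mul, Matrix.mul_one,
      ← isHermitian_eq_mul_diagonal_mul]
  rw [h1, Matrix.conjTranspose_mul]
  simp only [Matrix.mul_assoc]

end DecouplingMeasurement

/-! ### Exact state merging by decoupling -/

section Merging

theorem IsFiniteRoundLOCC.measureA_fintype {A B C A' B' ι : Type} [Fintype A] [DecidableEq A]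
    [Fintype B] [DecidableEq B] [Fintype C] [Fintype ι] (M : ι → Matrix C A ℂ)
    (hM : ∑ m, (M m)ᴴ * M m = 1)
    (E : ι → (Matrix (C × B) (C × B) ℂ →ₗ[ℂ] Matrix (A' × B') (A' × B') ℂ))
    (hE : ∀ m, IsFiniteRoundLOCC (E m)) :
    IsFiniteRoundLOCC (∑ m, E m ∘ₗ conjMap (M m ⊗ₖ (1 : Matrix B B ℂ))) := by
  have e := (Fintype.equivFin ι).symm
  rw [← Equiv.sum_comp e]
  refine IsFiniteRoundLOCC.measureA _ (fun m => M (e m)) ?_ (fun m => E (e m)) fun m => hE _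
  rw [← hM, ← Equiv.sum_comp e]

theorem IsFiniteRoundLOCC.measureB_fintype {A B C A' B' ι : Type} [Fintype A] [DecidableEq A]
    [Fintype B] [DecidableEq B] [Fintype C] [Fintype ι] (M : ι → Matrix C B ℂ)
    (hM : ∑ m, (M m)ᴴ * M m = 1)
    (E : ι → (Matrix (A × C) (A × C) ℂ →ₗ[ℂ] Matrix (A' × B') (A' × B') ℂ))
    (hE : ∀ m, IsFiniteRoundLOCC (E m)) :
    IsFiniteRoundLOCC (∑ m, E m ∘ₗ conjMap ((1 : Matrix A A ℂ) ⊗ₖ M m)) := by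
  have e := (Fintype.equivFin ι).symm
  rw [← Equiv.sum_comp e]
  refine IsFiniteRoundLOCC.measureB _ (fun m => M (e m)) ?_ (fun m => E (e m)) fun m => hE _
  rw [← hM, ← Equiv.sum_comp e]

/-- A measurement one outcome of which transforms a purification into another purification of the
same operator, whereas the other outcomes do not occur. -/
theorem exists_kraus_of_mul_conjTranspose_eq {X Z C : Type} [Fintype X] [DecidableEq X]
    [Fintype Z] [DecidableEq Z] [Fintype C] [DecidableEq C] (c : C) {Y : Matrix Z X ℂ}
    {Y' : Matrix Z C ℂ} (h : Y * Yᴴ = Y' * Y'ᴴ) :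
    ∃ N : Option X → Matrix C X ℂ, ∑ o, (N o)ᴴ * N o = 1 ∧ Y * (N none)ᵀ = Y' ∧
      ∀ x, Y * (N (some x))ᵀ = 0 := by
  obtain ⟨T, hT, hYT, hTT⟩ := exists_partialIsometry_of_mul_conjTranspose_eq h
  set P := (T * Tᴴ)ᵀ with hP
  have hPH : Pᴴ = P := by
    ext i j
    simp [hP, Matrix.mul_apply, mul_comm]
  have hPP : P * P = P := by rw [hP, ← Matrix.transpose_mul, hTT]
  refine ⟨fun o => o.elim Tᵀ fun x => Matrix.single c x (1 : ℂ) * (1 - P), ?_, ?_, fun x => ?_⟩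
  · simp only [Fintype.sum_option, Option.elim]
    rw [sum_single_mul_compl_projection hPH hPP]
    have : (Tᵀ)ᴴ * Tᵀ = P := by
      ext i j
      simp [hP, Matrix.mul_apply, mul_comm]
    rw [this, add_sub_cancel]
  · simpa using hT
  · simp only [Option.elim]
    rw [Matrix.transpose_mul, ← Matrix.mul_assoc, Matrix.transpose_sub, Matrix.transpose_one, hP,
      Matrix.transpose_transpose, Matrix.mul_sub, hYT, Matrix.mul_one, sub_self, Matrix.zero_mul]

theorem conjMap_vecMulVec {X Y : Type} [Fintype X] (M : Matrix Y X ℂ) (u v : X → ℂ) :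
    conjMap M (Matrix.vecMulVec u (star v)) =
      Matrix.vecMulVec (M.mulVec u) (star (M.mulVec v)) := by
  simp only [conjMap, LinearMap.coe_mk, AddHom.coe_mk]
  rw [Matrix.mul_vecMulVec, Matrix.vecMulVec_mul, Matrix.star_mulVec]

variable {R A B : Type} [Fintype R] [DecidableEq R] [Fintype A] [DecidableEq A]
  [Fintype B] [DecidableEq B]

/-- The unnormalized state of `R ⊗ ℂ^L ⊗ (B ⊗ ℂ^K)` after an outcome of the measurement of `A`,
as an operator. -/
def measuredAmplitude (ψ : R × A × B → ℂ) {K L : ℕ} (M : Matrix (Fin L) (A × Fin K) ℂ) :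
    Matrix (R × Fin L) (B × Fin K) ℂ :=
  fun x y => ∑ z, M x.2 z * initialVector ψ K (x.1, (z, y))

/-- The target state of merging, as an operator. -/
def targetAmplitude (ψ : R × A × B → ℂ) (L : ℕ) : Matrix (R × Fin L) ((A × B) × Fin L) ℂ :=
  fun x y => finalVector ψ L (x.1, (x.2, y))

theorem ofReal_one_div_sqrt_mul_self (n : ℕ) :
    ((1 / Real.sqrt n : ℝ) : ℂ) * ((1 / Real.sqrt n : ℝ) : ℂ) = 1 / n := by
  rw [← Complex.ofReal_mul, div_mul_div_comm, Real.mul_self_sqrt (Nat.cast_nonneg n)]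
  simp

omit [Fintype R] [DecidableEq R] [DecidableEq A] [DecidableEq B] in
-- Tracing out B and its half of Φ_K leaves A's half maximally mixed: hence the identity and the
-- 1/K.
theorem measuredAmplitude_mul_conjTranspose (ψ : R × A × B → ℂ) {K L : ℕ}
    (M : Matrix (Fin L) (A × Fin K) ℂ) (r r' : R) (l l' : Fin L) :
    (measuredAmplitude ψ M * (measuredAmplitude ψ M)ᴴ) (r, l) (r', l') =
      1 / K * (M * (block (reducedRA ψ) r r' ⊗ₖ (1 : Matrix (Fin K) (Fin K) ℂ)) * Mᴴ) l l' := by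
  have h1 : ∀ r l b k, measuredAmplitude ψ M (r, l) (b, k) =
      ∑ a, M l (a, k) * (ψ (r, a, b) * ((1 / Real.sqrt K : ℝ) : ℂ)) := fun r l b k => by
    simp only [measuredAmplitude, initialVector, maxEntangled, Fintype.sum_prod_type]
    refine Finset.sum_congr rfl fun a _ => ?_
    rw [Finset.sum_eq_single k (fun k' _ hk => by simp [hk]) (by simp)]
    simp
  have h2 : ∀ a' k, (M * (block (reducedRA ψ) r r' ⊗ₖ (1 : Matrix (Fin K) (Fin K) ℂ))) l (a', k) =
      ∑ a, M l (a, k) * ∑ b, ψ (r, a, b) * star (ψ (r', a', b)) := fun a' k => by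
    simp only [Matrix.mul_apply, Fintype.sum_prod_type, Matrix.kroneckerMap_apply,
      Matrix.one_apply]
    refine Finset.sum_congr rfl fun a _ => ?_
    rw [Finset.sum_eq_single k (fun k' _ hk => by simp [hk]) (by simp)]
    simp [block, reducedRA]
  rw [Matrix.mul_apply, Matrix.mul_apply]
  simp only [Matrix.conjTranspose_apply, Fintype.sum_prod_type, h1, h2, Finset.mul_sum,
    Finset.sum_mul, star_sum]
  calc _ = ∑ b, ∑ a', ∑ k, ∑ a, _ := Finset.sum_congr rfl fun b _ => Finset.sum_comm
    _ = ∑ a', ∑ b, ∑ k, ∑ a, _ := Finset.sum_comm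
    _ = ∑ a', ∑ k, ∑ b, ∑ a, _ := Finset.sum_congr rfl fun a' _ => Finset.sum_comm
    _ = ∑ a', ∑ k, ∑ a, ∑ b, _ := Finset.sum_congr rfl fun a' _ =>
      Finset.sum_congr rfl fun k _ => Finset.sum_comm
  refine Finset.sum_congr rfl fun a' _ => Finset.sum_congr rfl fun k _ =>
    Finset.sum_congr rfl fun a _ => Finset.sum_congr rfl fun b _ => ?_
  rw [← ofReal_one_div_sqrt_mul_self, star_mul', star_mul',
    show star ((1 / Real.sqrt K : ℝ) : ℂ) = ((1 / Real.sqrt K : ℝ) : ℂ) from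
      Complex.conj_ofReal _]
  ring

omit [Fintype R] [DecidableEq R] [DecidableEq A] [DecidableEq B] in
-- The marginal of the target is ψ^R ⊗ 1/L, the block trace being ⟨r|ψ^R|r'⟩.
theorem targetAmplitude_mul_conjTranspose (ψ : R × A × B → ℂ) (L : ℕ) (r r' : R)
    (l l' : Fin L) :
    (targetAmplitude ψ L * (targetAmplitude ψ L)ᴴ) (r, l) (r', l') =
      1 / L * ((block (reducedRA ψ) r r').trace * (1 : Matrix (Fin L) (Fin L) ℂ) l l') := by
  rw [Matrix.mul_apply]
  simp only [Matrix.conjTranspose_apply, Fintype.sum_prod_type, targetAmplitude, finalVector,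
    maxEntangled, Matrix.trace, Matrix.diag, block, Matrix.submatrix_apply, reducedRA,
    Finset.mul_sum, Finset.sum_mul]
  refine Finset.sum_congr rfl fun a _ => Finset.sum_congr rfl fun b _ => ?_
  rw [Finset.sum_eq_single l (fun k _ hk => by simp [Ne.symm hk]) (by simp)]
  rw [← ofReal_one_div_sqrt_mul_self, star_mul', Matrix.one_apply]
  by_cases h : l = l'
  · subst h
    rw [if_pos rfl, if_pos rfl,
      show star ((1 / Real.sqrt L : ℝ) : ℂ) = ((1 / Real.sqrt L : ℝ) : ℂ) from
        Complex.conj_ofReal _]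
    ring
  · rw [if_neg h, if_neg (Ne.symm h)]
    simp

/-- A measurement of `A` all of whose outcomes decouple `R` from a maximally mixed output is
completed to a protocol for exact state merging. -/
theorem exactMerging_of_decoupling {ψ : R × A × B → ℂ} (hψ : ∑ x, ‖ψ x‖ ^ 2 = 1) {K L : ℕ}
    (hK : 0 < K) (hL : 0 < L) {ι : Type} [Fintype ι] {M : ι → Matrix (Fin L) (A × Fin K) ℂ}
    {q : ι → ℝ} (hM : ∑ m, (M m)ᴴ * M m = 1) (hq0 : ∀ m, 0 ≤ q m) (hq1 : ∑ m, q m = 1)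
    (h : ∀ m r r',
      M m * (block (reducedRA ψ) r r' ⊗ₖ (1 : Matrix (Fin K) (Fin K) ℂ)) * (M m)ᴴ =
        ((q m : ℂ) * (K / L) * (block (reducedRA ψ) r r').trace) •
          (1 : Matrix (Fin L) (Fin L) ℂ)) :
    ExactMerging ψ K L := by
  have hK' : (K : ℂ) ≠ 0 := by exact_mod_cast hK.ne'
  -- Only needed for a basis vector onto which B's never-occurring outcomes can be sent.
  have hne : Nonempty (R × A × B) := by
    by_contra hne
    rw [not_nonempty_iff] at hne
    simp at hψ
  obtain ⟨-, a₀, b₀⟩ := hne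
  have hsq : ∀ m, ((Real.sqrt (q m) : ℝ) : ℂ) * ((Real.sqrt (q m) : ℝ) : ℂ) = q m := fun m => by
    rw [← Complex.ofReal_mul, Real.mul_self_sqrt (hq0 m)]
  have hstar : ∀ x : ℝ, star (x : ℂ) = x := Complex.conj_ofReal
  -- Decoupling says that the state after outcome m and √q_m times the target purify the same
  -- operator on R ⊗ ℂ^L.
  have hY : ∀ m, measuredAmplitude ψ (M m) * (measuredAmplitude ψ (M m))ᴴ =
      (((Real.sqrt (q m) : ℝ) : ℂ) • targetAmplitude ψ L) *
        (((Real.sqrt (q m) : ℝ) : ℂ) • targetAmplitude ψ L)ᴴ := fun m => by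
    rw [Matrix.conjTranspose_smul, Matrix.smul_mul, Matrix.mul_smul, smul_smul, hstar, hsq]
    ext ⟨r, l⟩ ⟨r', l'⟩
    rw [measuredAmplitude_mul_conjTranspose, h, Matrix.smul_apply, Matrix.smul_apply,
      targetAmplitude_mul_conjTranspose, smul_eq_mul, smul_eq_mul]
    field_simp
  choose N hN hN0 hN1 using fun m =>
    exists_kraus_of_mul_conjTranspose_eq ((a₀, b₀), (⟨0, hL⟩ : Fin L)) (hY m)
  refine ⟨∑ m, (∑ o, LinearMap.id ∘ₗ conjMap ((1 : Matrix (Fin L) (Fin L) ℂ) ⊗ₖ N m o)) ∘ₗ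
    conjMap (M m ⊗ₖ (1 : Matrix (B × Fin K) (B × Fin K) ℂ)),
    IsFiniteRoundLOCC.measureA_fintype M hM _ fun m =>
      IsFiniteRoundLOCC.measureB_fintype (N m) (hN m) _ fun _ => IsFiniteRoundLOCC.done, ?_⟩
  have hvec : ∀ m o r p, (((1 : Matrix (Fin L) (Fin L) ℂ) ⊗ₖ N m o).mulVec
      ((M m ⊗ₖ (1 : Matrix (B × Fin K) (B × Fin K) ℂ)).mulVec
        fun x => initialVector ψ K (r, x))) p =
      (measuredAmplitude ψ (M m) * (N m o)ᵀ) (r, p.1) p.2 := by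
    rintro m o r ⟨l, c⟩
    have h1 : ∀ l y, (M m ⊗ₖ (1 : Matrix (B × Fin K) (B × Fin K) ℂ)).mulVec
        (fun x => initialVector ψ K (r, x)) (l, y) = measuredAmplitude ψ (M m) (r, l) y :=
      fun l y => by
        simp only [Matrix.mulVec, dotProduct, Matrix.kroneckerMap_apply, measuredAmplitude,
          Matrix.one_apply]
        rw [Fintype.sum_prod_type]
        refine Finset.sum_congr rfl fun z _ => ?_
        rw [Finset.sum_eq_single y (fun y' _ hy => by simp [Ne.symm hy]) (by simp)]
        simp
    generalize (M m ⊗ₖ (1 : Matrix (B × Fin K) (B × Fin K) ℂ)).mulVec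
      (fun x => initialVector ψ K (r, x)) = v at h1
    simp only [Matrix.mulVec, dotProduct, Matrix.kroneckerMap_apply, Matrix.mul_apply,
      Matrix.one_apply, Matrix.transpose_apply]
    rw [Fintype.sum_prod_type, Finset.sum_eq_single l (fun l' _ hl => by simp [Ne.symm hl])
      (by simp)]
    refine Finset.sum_congr rfl fun y _ => ?_
    rw [h1]
    simp [mul_comm]
  ext ⟨r, p⟩ ⟨r', p'⟩
  -- `idTensor` acts on the blocks |u_r⟩⟨u_{r'}| of the pure state, so operators with two different
  -- vectors are required.
  have happ : ∀ u v : (A × Fin K) × (B × Fin K) → ℂ,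
      (∑ m, (∑ o, LinearMap.id ∘ₗ conjMap ((1 : Matrix (Fin L) (Fin L) ℂ) ⊗ₖ N m o)) ∘ₗ
        conjMap (M m ⊗ₖ (1 : Matrix (B × Fin K) (B × Fin K) ℂ))) (Matrix.vecMulVec u (star v)) =
      ∑ m, ∑ o, Matrix.vecMulVec
        (((1 : Matrix (Fin L) (Fin L) ℂ) ⊗ₖ N m o).mulVec
          ((M m ⊗ₖ (1 : Matrix (B × Fin K) (B × Fin K) ℂ)).mulVec u))
        (star (((1 : Matrix (Fin L) (Fin L) ℂ) ⊗ₖ N m o).mulVec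
          ((M m ⊗ₖ (1 : Matrix (B × Fin K) (B × Fin K) ℂ)).mulVec v))) := fun u v => by
    rw [LinearMap.sum_apply]
    refine Finset.sum_congr rfl fun m _ => ?_
    rw [LinearMap.comp_apply, conjMap_vecMulVec, LinearMap.sum_apply]
    refine Finset.sum_congr rfl fun o _ => ?_
    rw [LinearMap.id_comp, conjMap_vecMulVec]
  refine (congrFun (congrFun (happ (fun x => initialVector ψ K (r, x))
    fun x => initialVector ψ K (r', x)) p) p').trans ?_
  simp only [Matrix.sum_apply, Matrix.vecMulVec_apply, Pi.star_apply, hvec]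
  simp only [Fintype.sum_option, hN0, hN1, Matrix.zero_apply, zero_mul, Finset.sum_const_zero, add_zero, Matrix.smul_apply,
    smul_eq_mul, star_mul', hstar]
  have h1 : ∀ m (x y : ℂ), ((Real.sqrt (q m) : ℝ) : ℂ) * x * (((Real.sqrt (q m) : ℝ) : ℂ) * y) =
      q m * (x * y) := fun m x y => by rw [← hsq]; ring
  simp only [h1, ← Finset.sum_mul, ← Complex.ofReal_sum, hq1, Complex.ofReal_one, one_mul]
  rfl

omit [DecidableEq R] [DecidableEq A] [DecidableEq B] in
/-- The Schmidt ranks of the maximally entangled states that are consumed and returned are chosen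
with a ratio slightly above `max_j λ_0 dim a_j^R`. -/
theorem TripartiteForm.exists_ranks {ψ : R × A × B → ℂ} {D : BlockDecomposition A}
    (T : TripartiteForm ψ D) {δ : ℝ} (hδ : 0 < δ) :
    ∃ K L : ℕ, 0 < K ∧ 0 < L ∧ (∀ j, T.lambda0 j * D.dR j * L ≤ K) ∧
      Real.logb 2 K - Real.logb 2 L ≤ (⨆ j, Real.logb 2 (T.lambda0 j * D.dR j)) + δ := by
  have : Nonempty (Fin D.J) := ⟨⟨0, T.J_pos⟩⟩
  obtain ⟨i, hi⟩ := Finite.exists_max fun j => T.lambda0 j * D.dR j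
  set c := T.lambda0 i * D.dR i with hc
  have hc0 : 0 < c := mul_pos (T.lambda0_pos i) (by exact_mod_cast D.dR_pos i)
  have h2 : c < c * 2 ^ δ := lt_mul_of_one_lt_right hc0 (Real.one_lt_rpow (by norm_num) hδ)
  -- K and L are the numerator and denominator of a rational between c and c · 2^δ: the lower bound
  -- permits decoupling, the upper one bounds the cost.
  obtain ⟨x, hx1, hx2⟩ := exists_rat_btwn h2
  have hx0 : 0 < x := by exact_mod_cast hc0.trans hx1
  have hden : (0 : ℝ) < x.den := by exact_mod_cast x.den_pos
  have hnum : 0 < x.num.toNat := by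
    have := Rat.num_pos.2 hx0
    omega
  have hx : (x : ℝ) = x.num.toNat / x.den := by
    have h3 : ((x.num.toNat : ℤ) : ℝ) = x.num := by
      rw [Int.toNat_of_nonneg (Rat.num_pos.2 hx0).le]
    rw [Rat.cast_def, ← h3]
    rfl
  refine ⟨x.num.toNat, x.den, hnum, x.den_pos, fun j => ?_, ?_⟩
  · refine (mul_le_mul_of_nonneg_right ((hi j).trans hx1.le) hden.le).trans ?_
    rw [hx, div_mul_cancel₀ _ hden.ne']
  · rw [← Real.logb_div (by exact_mod_cast hnum.ne') hden.ne', ← hx]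
    have h3 : Real.logb 2 x ≤ Real.logb 2 c + δ := by
      have h4 : Real.logb 2 (c * 2 ^ δ) = Real.logb 2 c + δ := by
        rw [Real.logb_mul hc0.ne' (Real.rpow_pos_of_pos (by norm_num) δ).ne',
          Real.logb_rpow (by norm_num) (by norm_num)]
      rw [← h4]
      exact Real.logb_le_logb_of_le (by norm_num) (hc0.trans hx1) hx2.le
    have h5 : Real.logb 2 c ≤ ⨆ j, Real.logb 2 (T.lambda0 j * D.dR j) :=
      le_ciSup (f := fun j => Real.logb 2 (T.lambda0 j * D.dR j))
        (Set.finite_range _).bddAbove i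
    linarith

end Merging

end StateMerging

end

theorem mainTheorem2 {R A B : Type} [Fintype R] [DecidableEq R] [Fintype A] [DecidableEq A]
    [Fintype B] [DecidableEq B] (ψ : R × A × B → ℂ) (hψ : ∑ x, ‖ψ x‖ ^ 2 = 1)
    (D : StateMerging.BlockDecomposition A)
    (ω : ∀ j, Matrix (Fin (D.dL j)) (Fin (D.dL j)) ℂ)
    (hD : StateMerging.IsKoashiImoto (StateMerging.steeredStates ψ) D ω) :
    Nonempty (StateMerging.TripartiteForm ψ D) ∧
    ∀ (T : StateMerging.TripartiteForm ψ D) (δ : ℝ), 0 < δ →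
      ∃ K L : ℕ, 0 < K ∧ 0 < L ∧ StateMerging.ExactMerging ψ K L ∧
        Real.logb 2 K - Real.logb 2 L ≤
          (⨆ j, Real.logb 2 (T.lambda0 j * D.dR j)) + δ := by
  refine ⟨StateMerging.nonempty_tripartiteForm hψ hD, fun T δ hδ => ?_⟩
  obtain ⟨K, L, hK, hL, hKL, hcost⟩ := T.exists_ranks hδ
  obtain ⟨ι, _, M, q, hM, hq0, hq1, hMq⟩ := T.exists_decoupling_measurement hK hL hKL
  exact ⟨K, L, hK, hL, StateMerging.exactMerging_of_decoupling hψ hK hL hM hq0 hq1 hMq, hcost⟩
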